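/- Let $T>0$ and $\Lambda=[0,T]\times[0,T]\subset\mathbb R^2$. Let $\chi\in C^1([0,T])$ be increasing with $\chi'\neq 0$ on $[0,T]$, let $0\le\beta\le1$, and let $\gamma,\omega,s\in C(\Lambda)$. For $p\in C(\Lambda)$ write $p^-=\operatorname{ess\,inf}_\Lambda p$ and $p^+=\operatorname{ess\,sup}_\Lambda p$. Assume $$1<\omega^-\le\omega^+<\gamma^-\le\gamma^+<s^-\le s^+ .$$ Let $\alpha=(\alpha_1,\alpha_2)$ satisfy $1/\gamma(\xi)<\alpha_j<1$ for all $\xi\in\Lambda$ and $j=1,2$. Let $\eta,\mathcal A\in C(\Lambda)$ be non-negative and let $\lambda>0$. For $\mu_1,\mu_2>0$ put $$\mathbf I^{\mu;\chi}f(\xi_1,\xi_2)=\frac{1}{\Gamma(\mu_1)\Gamma(\mu_2)}\int_0^{\xi_1}\!\!\int_0^{\xi_2}\chi'(s_1)\chi'(s_2)(\chi(\xi_1)-\chi(s_1))^{\mu_1-1}(\chi(\xi_2)-\chi(s_2))^{\mu_2-1}f(s_1,s_2)\,ds_2\,ds_1,$$ and let $\mathbf I^{0;\chi}$ be the identity.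 For $u\in C_0^\infty(\Lambda)$ (smooth functions with compact support in the open square $(0,T)^2$) the $\chi$-Hilfer derivative of order $\alpha$ and type $\beta$ is $$\mathfrak D u=\mathbf I^{\beta(1-\alpha);\chi}\Big(\frac{1}{\chi'(\xi_1)\chi'(\xi_2)}\frac{\partial^2}{\partial\xi_1\partial\xi_2}\Big)\mathbf I^{(1-\beta)(1-\alpha);\chi}u .$$ Let $\mathcal H=\mathcal H^{\alpha,\beta;\chi}_{\gamma(\xi)}(\Lambda)$ be the closure of $C_0^\infty(\Lambda)$ for the norm $$\inf\Big\{k>0:\int_\Lambda\Big|\frac{\phi}{k}\Big|^{\gamma(\xi)}+\Big|\frac{\mathfrak D\phi}{k}\Big|^{\gamma(\xi)}d\xi\le1\Big\};$$ that is, $\phi\in L^{\gamma(\xi)}(\Lambda)$ belongs to $\mathcal H$, with derivative $\mathfrak D\phi\in L^{\gamma(\xi)}(\Lambda)$, if there are $u_n\in C_0^\infty(\Lambda)$ such that $(u_n,\mathfrak Du_n)\to(\phi,\mathfrak D\phi)$ in this norm. Equip $\mathcal H$ with $$\|\phi\|=\inf\Big\{k>0:\int_\Lambda\Big|\frac{\mathfrak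 D\phi}{k}\Big|^{\gamma(\xi)}d\xi\le1\Big\}.$$ Define the energy functional on $\mathcal H$ by $$\mathfrak E_\lambda(\phi)=\int_\Lambda\frac{1}{\gamma(\xi)}|\mathfrak D\phi|^{\gamma(\xi)}d\xi-\lambda\int_\Lambda\frac{1}{\omega(\xi)}\eta(\xi)|\phi|^{\omega(\xi)}d\xi-\int_\Lambda\frac{1}{s(\xi)}\mathcal A(\xi)|\phi|^{s(\xi)}d\xi$$ and the Nehari manifold by $\mathfrak M_\lambda(\Lambda)=\{\phi\in\mathcal H\setminus\{0\}:\langle\mathfrak E_\lambda'(\phi),\phi\rangle=0\}$, where $\langle\mathfrak E_\lambda'(\phi),\phi\rangle$ is the derivative of $\mathfrak E_\lambda$ at $\phi$ in the direction $\phi$. Then $\mathfrak E_\lambda$ is bounded below and coercive on $\mathfrak M_\lambda(\Lambda)$: we have $\inf_{\mathfrak M_\lambda(\Lambda)}\mathfrak E_\lambda>-\infty$ (when $\mathfrak M_\lambda(\Lambda)\ne\emptyset$), and $\mathfrak E_\lambda(\phi)\to+\infty$ as $\|\phi\|\to\infty$ with $\phi\in\mathfrak M_\lambda(\Lambda)$.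 -/

import Mathlib

open MeasureTheory Filter Topology
open scoped ContDiff

noncomputable section

namespace HilferNehari

/-- The closed square `Λ = [0,T] × [0,T]`. -/
def square (T : ℝ) : Set (ℝ × ℝ) := Set.Icc 0 T ×ˢ Set.Icc 0 T

/-- The derivative `χ'` of `χ` on `[0,T]` (one-sided at the end points). -/
def dchi (T : ℝ) (χ : ℝ → ℝ) (x : ℝ) : ℝ := derivWithin χ (Set.Icc 0 T) x

/-- The left-sided `χ`-Riemann-Liouville integral of order `μ ≥ 0` in one variable,
`(1/Γ(μ)) ∫₀ˣ χ'(s) (χ(x) - χ(s))^(μ-1) f(s) ds`, with the usual convention that order `0` is the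
identity. -/
def fracInt₁ (T : ℝ) (χ : ℝ → ℝ) (μ : ℝ) (f : ℝ → ℝ) (x : ℝ) : ℝ :=
  if μ = 0 then f x
  else (1 / Real.Gamma μ) * ∫ s in (0 : ℝ)..x, dchi T χ s * (χ x - χ s) ^ (μ - 1) * f s

/-- The left-sided `χ`-Riemann-Liouville partial integral of order `(μ₁, μ₂)` in two variables. -/
def fracInt (T : ℝ) (χ : ℝ → ℝ) (μ₁ μ₂ : ℝ) (f : ℝ × ℝ → ℝ) (ξ : ℝ × ℝ) : ℝ :=
  fracInt₁ T χ μ₁ (fun x => fracInt₁ T χ μ₂ (fun y => f (x, y)) ξ.2) ξ.1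

/-- The operator `(1 / (χ'(ξ₁) χ'(ξ₂))) ∂²/∂ξ₁∂ξ₂`. -/
def mixedDeriv (T : ℝ) (χ : ℝ → ℝ) (f : ℝ × ℝ → ℝ) (ξ : ℝ × ℝ) : ℝ :=
  (1 / (dchi T χ ξ.1 * dchi T χ ξ.2)) * deriv (fun x => deriv (fun y => f (x, y)) ξ.2) ξ.1

/-- The (pointwise) left-sided `χ`-Hilfer partial derivative of order `(α₁, α₂)` and type `β`,
`I^{β(1-α);χ} ((1/χ') ∂²/∂ξ₁∂ξ₂) I^{(1-β)(1-α);χ} f`. -/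
def hilfer (T : ℝ) (χ : ℝ → ℝ) (α₁ α₂ β : ℝ) (f : ℝ × ℝ → ℝ) : ℝ × ℝ → ℝ :=
  fracInt T χ (β * (1 - α₁)) (β * (1 - α₂))
    (mixedDeriv T χ (fracInt T χ ((1 - β) * (1 - α₁)) ((1 - β) * (1 - α₂)) f))

/-- Membership in the variable exponent Lebesgue space `L^{γ(ξ)}(Λ)`. -/
def MemLVar (T : ℝ) (γ φ : ℝ × ℝ → ℝ) : Prop :=
  AEStronglyMeasurable φ (volume.restrict (square T)) ∧
    IntegrableOn (fun ξ => |φ ξ| ^ γ ξ) (square T)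

/-- The Luxemburg norm `inf {k > 0 : ∫_Λ |φ/k|^{γ(ξ)} dξ ≤ 1}`. -/
def luxNorm (T : ℝ) (γ φ : ℝ × ℝ → ℝ) : ℝ :=
  sInf {k : ℝ | 0 < k ∧ IntegrableOn (fun ξ => |φ ξ / k| ^ γ ξ) (square T) ∧
    ∫ ξ in square T, |φ ξ / k| ^ γ ξ ≤ 1}

/-- The Luxemburg type norm `inf {k > 0 : ∫_Λ |φ/k|^{γ(ξ)} + |g/k|^{γ(ξ)} dξ ≤ 1}`; it is the norm
of the fractional derivative space when `g` is the fractional derivative of `φ`. -/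
def graphNorm (T : ℝ) (γ φ g : ℝ × ℝ → ℝ) : ℝ :=
  sInf {k : ℝ | 0 < k ∧
    IntegrableOn (fun ξ => |φ ξ / k| ^ γ ξ + |g ξ / k| ^ γ ξ) (square T) ∧
    ∫ ξ in square T, (|φ ξ / k| ^ γ ξ + |g ξ / k| ^ γ ξ) ≤ 1}

/-- `C₀^∞(Λ)`: smooth functions with compact support in the open square. -/
def IsTest (T : ℝ) (u : ℝ × ℝ → ℝ) : Prop :=
  ContDiff ℝ ∞ u ∧ HasCompactSupport u ∧ tsupport u ⊆ Set.Ioo 0 T ×ˢ Set.Ioo 0 T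

/-- `(φ, g)` lies in the closure, for the norm of the fractional derivative space, of the pairs
`(u, D u)` with `u ∈ C₀^∞(Λ)` and `D` the pointwise `χ`-Hilfer derivative: `φ` is in the closure of
`C₀^∞(Λ)` and `g` is its `χ`-Hilfer derivative. -/
def HasHilferDeriv (T : ℝ) (χ : ℝ → ℝ) (α₁ α₂ β : ℝ) (γ φ g : ℝ × ℝ → ℝ) : Prop :=
  MemLVar T γ φ ∧ MemLVar T γ g ∧
    ∃ u : ℕ → ℝ × ℝ → ℝ,
      (∀ n, IsTest T (u n) ∧ MemLVar T γ (hilfer T χ α₁ α₂ β (u n))) ∧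
      Tendsto (fun n => graphNorm T γ (φ - u n) (g - hilfer T χ α₁ α₂ β (u n))) atTop (𝓝 0)

/-- The `χ`-fractional derivative space: the closure of `C₀^∞(Λ)` in the norm `graphNorm`. -/
def space (T : ℝ) (χ : ℝ → ℝ) (α₁ α₂ β : ℝ) (γ : ℝ × ℝ → ℝ) : Set (ℝ × ℝ → ℝ) :=
  {φ | ∃ g, HasHilferDeriv T χ α₁ α₂ β γ φ g}

open Classical in
/-- The `χ`-Hilfer derivative of an element of the space (determined up to a null set of `Λ`; the
value outside the space is immaterial). -/
def hilferDeriv (T : ℝ) (χ : ℝ → ℝ) (α₁ α₂ β : ℝ) (γ φ : ℝ × ℝ → ℝ) : ℝ × ℝ → ℝ :=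
  if h : ∃ g, HasHilferDeriv T χ α₁ α₂ β γ φ g then h.choose else 0

/-- The norm `‖φ‖ = |D φ|_{γ(ξ)}` on the space. -/
def spaceNorm (T : ℝ) (χ : ℝ → ℝ) (α₁ α₂ β : ℝ) (γ φ : ℝ × ℝ → ℝ) : ℝ :=
  luxNorm T γ (hilferDeriv T χ α₁ α₂ β γ φ)

/-- The Euler (energy) functional `𝔈_λ`. -/
def energy (T : ℝ) (χ : ℝ → ℝ) (α₁ α₂ β : ℝ) (γ w s η A : ℝ × ℝ → ℝ) (lam : ℝ)
    (φ : ℝ × ℝ → ℝ) : ℝ :=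
  (∫ ξ in square T, 1 / γ ξ * |hilferDeriv T χ α₁ α₂ β γ φ ξ| ^ γ ξ)
    - lam * (∫ ξ in square T, 1 / w ξ * η ξ * |φ ξ| ^ w ξ)
    - ∫ ξ in square T, 1 / s ξ * A ξ * |φ ξ| ^ s ξ

/-- The Nehari manifold: the nonzero `φ` in the space with `⟨𝔈_λ'(φ), φ⟩ = 0`, that is, the
derivative of `𝔈_λ` at `φ` in the direction `φ` exists and is `0`. -/
def nehari (T : ℝ) (χ : ℝ → ℝ) (α₁ α₂ β : ℝ) (γ w s η A : ℝ × ℝ → ℝ) (lam : ℝ) :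
    Set (ℝ × ℝ → ℝ) :=
  {φ | φ ∈ space T χ α₁ α₂ β γ ∧ ¬ (φ =ᵐ[volume.restrict (square T)] 0) ∧
    HasLineDerivAt ℝ (energy T χ α₁ α₂ β γ w s η A lam) 0 φ φ}

/-- `p⁻ = ess inf_Λ p`. -/
def expInf (T : ℝ) (p : ℝ × ℝ → ℝ) : ℝ := essInf p (volume.restrict (square T))

/-- `p⁺ = ess sup_Λ p`. -/
def expSup (T : ℝ) (p : ℝ × ℝ → ℝ) : ℝ := essSup p (volume.restrict (square T))

end HilferNehari

end

noncomputable section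

namespace HilferNehari

open Set

/-! Write ρ = ∫|𝔇φ|^γ, B = ∫η|φ|^ω, D = ∫𝒜|φ|^s. On the Nehari manifold ρ = λB + D
(`nehari_identity`). Eliminating D from the energy gives 𝔈 ≥ (1/γ⁺ - 1/s⁻)ρ - (λ/ω⁻)B, whose first
coefficient is positive because γ⁺ < s⁻ (`exists_energy_lower_bound`). For ‖φ‖ > 2 the modular
satisfies ρ ≥ (‖φ‖/2)^{γ⁻} (`le_integral_of_two_lt_luxNorm`), while B grows at most like (1 +
C‖φ‖)^{ω⁺}. Since ω⁺ < γ⁻, the first term wins.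

The bound on B rests on the estimate sup|φ| ≤ C‖φ‖ (`exists_abs_le_luxNorm`). In the coordinates
χ(ξ₁), χ(ξ₂) the fractional integrals are convolutions with the Riemann-Liouville measures, which
form a convolution semigroup (`rlMeasure_conv`). For a test function this gives u = I^α 𝔇u
(`rl_lift_hilfer`). The kernel of I^α lies locally in L^q, with q conjugate to γ⁻, exactly because
α_j > 1/γ⁻. Hence I^α is bounded into L^∞ (`exists_kernel_bound`), and φ = I^α 𝔇φ passes to the
closure (`ae_eq_rl`).

The Nehari identity comes from differentiating t ↦ 𝔈((1+t)φ) at 0. This requires 𝔇((1+t)φ) = (1+t)𝔇φ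
almost everywhere, although 𝔇 is defined by a choice. Uniqueness of the derivative
(`hasHilferDeriv_unique`) follows from injectivity of I^α, since I^{1-α}I^α = I^1 and the integrals
over quadrants determine an integrable function. -/

/-! ### Riemann-Liouville measures and their semigroup law. -/

/-- The density `r^(μ-1) / Γ(μ)` on `(0, ∞)`. -/
def rlDensity (μ r : ℝ) : ℝ := if 0 < r then r ^ (μ - 1) / Real.Gamma μ else 0

/-- The Riemann-Liouville measure of order `μ`, equal to the Dirac mass at `0` for `μ = 0`. -/
def rlMeasure (μ : ℝ) : Measure ℝ :=
  if μ = 0 then Measure.dirac 0 else volume.withDensity fun r => ENNReal.ofReal (rlDensity μ r)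

lemma measurable_rlDensity (μ : ℝ) : Measurable (rlDensity μ) :=
  Measurable.ite measurableSet_Ioi ((measurable_id.pow_const _).div_const _) measurable_const

lemma rlDensity_nonneg {μ : ℝ} (hμ : 0 ≤ μ) (r : ℝ) : 0 ≤ rlDensity μ r := by
  unfold rlDensity
  split_ifs with h
  · exact div_nonneg (Real.rpow_nonneg h.le _) (Real.Gamma_nonneg_of_nonneg hμ)
  · exact le_rfl

lemma rlMeasure_of_ne {μ : ℝ} (hμ : μ ≠ 0) :
    rlMeasure μ = volume.withDensity fun r => ENNReal.ofReal (rlDensity μ r) := if_neg hμ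

lemma rlMeasure_zero : rlMeasure 0 = Measure.dirac 0 := if_pos rfl

instance (μ : ℝ) : SigmaFinite (rlMeasure μ) := by
  unfold rlMeasure
  split_ifs
  · infer_instance
  · exact SigmaFinite.withDensity (fun r => (rlDensity μ r).toNNReal)

lemma rlMeasure_absolutelyContinuous {μ : ℝ} (hμ : μ ≠ 0) : rlMeasure μ ≪ volume := by
  rw [rlMeasure_of_ne hμ]
  exact withDensity_absolutelyContinuous _ _

lemma ae_rlMeasure_nonneg (μ : ℝ) : ∀ᵐ r ∂rlMeasure μ, 0 ≤ r := by
  unfold rlMeasure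
  split_ifs
  · rw [ae_dirac_iff measurableSet_Ici]
  · rw [ae_withDensity_iff (measurable_rlDensity μ).ennreal_ofReal]
    refine ae_of_all _ fun r hr => ?_
    by_contra! h
    exact hr (by simp [rlDensity, not_lt.2 h.le])

/-- For x > 0 the substitution y = xθ turns the convolution into the Beta density in θ, which has
total mass one. For x < 0 one of the two factors always vanishes. -/
lemma lconvolution_rlDensity {a b : ℝ} (ha : 0 < a) (hb : 0 < b) (x : ℝ) (hx : x ≠ 0) :
    ((fun r => ENNReal.ofReal (rlDensity a r)) ⋆ₗ[volume]
      fun r => ENNReal.ofReal (rlDensity b r)) x = ENNReal.ofReal (rlDensity (a + b) x) := by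
  rw [lconvolution_def]
  have hab : 0 < a + b := add_pos ha hb
  rcases lt_or_gt_of_ne hx with hx | hx
  · have : ∀ y, ENNReal.ofReal (rlDensity a y) * ENNReal.ofReal (rlDensity b (-y + x)) = 0 := by
      intro y
      rcases le_or_gt y 0 with hy | hy
      · simp [rlDensity, not_lt.2 hy]
      · simp [rlDensity, not_lt.2 (show -y + x ≤ 0 by linarith)]
    rw [lintegral_congr this]
    simp [rlDensity, not_lt.2 hx.le]
  · have hcv := lintegral_image_eq_lintegral_abs_deriv_mul (s := univ) (f := fun θ => x * θ)
      (f' := fun _ => x) MeasurableSet.univ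
      (fun θ _ => (by simpa using (hasDerivAt_id θ).const_mul x :
        HasDerivAt (fun θ => x * θ) x θ).hasDerivWithinAt)
      (fun p _ q _ h => mul_left_cancel₀ hx.ne' h)
      (fun y => ENNReal.ofReal (rlDensity a y) * ENNReal.ofReal (rlDensity b (-y + x)))
    have himg : (fun θ => x * θ) '' univ = univ :=
      image_univ_of_surjective fun y => ⟨y / x, by field_simp⟩
    rw [himg, Measure.restrict_univ] at hcv
    rw [hcv]
    have hpt : ∀ θ, ENNReal.ofReal |x| *
        (ENNReal.ofReal (rlDensity a (x * θ)) * ENNReal.ofReal (rlDensity b (-(x * θ) + x)))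
        = ENNReal.ofReal (rlDensity (a + b) x) * ProbabilityTheory.betaPDF a b θ := by
      intro θ
      rw [← ENNReal.ofReal_mul (rlDensity_nonneg ha.le _), ← ENNReal.ofReal_mul (abs_nonneg _),
        ProbabilityTheory.betaPDF_eq, ← ENNReal.ofReal_mul (rlDensity_nonneg hab.le _)]
      congr 1
      have h2 : 0 < -(x * θ) + x ↔ θ < 1 := by
        rw [show -(x * θ) + x = x * (1 - θ) by ring, mul_pos_iff_of_pos_left hx, sub_pos]
      simp only [rlDensity, mul_pos_iff_of_pos_left hx, h2, hx, if_true]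
      by_cases h0 : 0 < θ
      · by_cases h1 : θ < 1
        · simp only [h0, h1, and_self, if_true]
          have h1' : 0 < 1 - θ := sub_pos.2 h1
          rw [show -(x * θ) + x = x * (1 - θ) by ring, Real.mul_rpow hx.le h0.le,
            Real.mul_rpow hx.le h1'.le, abs_of_pos hx, ProbabilityTheory.beta,
            show x ^ (a + b - 1) = x * x ^ (a - 1) * x ^ (b - 1) by
              rw [← Real.rpow_one_add' hx.le (by linarith), ← Real.rpow_add hx]; ring_nf]
          have := (Real.Gamma_pos_of_pos ha).ne'
          have := (Real.Gamma_pos_of_pos hb).ne'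
          have := (Real.Gamma_pos_of_pos hab).ne'
          field_simp
        · simp [h1]
      · simp [h0]
    simp_rw [hpt]
    rw [lintegral_const_mul _ (by
      have := ProbabilityTheory.measurable_betaPDFReal a b
      exact this.ennreal_ofReal),
      ProbabilityTheory.lintegral_betaPDF_eq_one ha hb, mul_one]

lemma rlMeasure_conv {a b : ℝ} (ha : 0 ≤ a) (hb : 0 ≤ b) :
    rlMeasure a ∗ rlMeasure b = rlMeasure (a + b) := by
  rcases ha.eq_or_lt with rfl | ha
  · rw [rlMeasure_zero, Measure.dirac_zero_conv, zero_add]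
  rcases hb.eq_or_lt with rfl | hb
  · rw [rlMeasure_zero, Measure.conv_dirac_zero, add_zero]
  rw [rlMeasure_of_ne ha.ne', rlMeasure_of_ne hb.ne', rlMeasure_of_ne (add_pos ha hb).ne',
    conv_withDensity_eq_lconvolution (measurable_rlDensity a).ennreal_ofReal
      (measurable_rlDensity b).ennreal_ofReal]
  refine withDensity_congr_ae ?_
  have h0 : ∀ᵐ x : ℝ, x ≠ 0 := by simp [ae_iff, measure_singleton]
  filter_upwards [h0] with x hx using lconvolution_rlDensity ha hb x hx

lemma prod_conv_prod {μ₁ μ₂ ν₁ ν₂ : Measure ℝ} [SFinite μ₁] [SFinite μ₂] [SFinite ν₁]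
    [SFinite ν₂] :
    (μ₁.prod μ₂) ∗ (ν₁.prod ν₂) = (μ₁ ∗ ν₁).prod (μ₂ ∗ ν₂) := by
  refine Measure.ext_of_lintegral _ fun f hf => ?_
  rw [Measure.lintegral_conv hf, lintegral_prod _ (by fun_prop), lintegral_prod _ (by fun_prop),
    Measure.lintegral_conv (by fun_prop)]
  have h : ∀ x, ∫⁻ y, f (x, y) ∂(μ₂ ∗ ν₂) = ∫⁻ y, ∫⁻ z, f (x, y + z) ∂ν₂ ∂μ₂ := fun x =>
    Measure.lintegral_conv (by fun_prop)
  refine lintegral_congr fun x₁ => ?_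
  simp_rw [h]
  rw [lintegral_congr fun x₂ => lintegral_prod (fun y => f ((x₁, x₂) + y)) (by fun_prop),
    lintegral_lintegral_swap (by fun_prop)]
  rfl

/-- The two-dimensional Riemann-Liouville measure of order `(a, b)`. -/
def rlMeasure₂ (a b : ℝ) : Measure (ℝ × ℝ) := (rlMeasure a).prod (rlMeasure b)

instance (a b : ℝ) : SigmaFinite (rlMeasure₂ a b) := by unfold rlMeasure₂; infer_instance

lemma rlMeasure₂_conv {a b c e : ℝ} (ha : 0 ≤ a) (hb : 0 ≤ b) (hc : 0 ≤ c) (he : 0 ≤ e) :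
    rlMeasure₂ a b ∗ rlMeasure₂ c e = rlMeasure₂ (a + c) (b + e) := by
  unfold rlMeasure₂
  rw [prod_conv_prod, rlMeasure_conv ha hc, rlMeasure_conv hb he]

lemma ae_rlMeasure₂_nonneg (a b : ℝ) : ∀ᵐ r ∂rlMeasure₂ a b, 0 ≤ r.1 ∧ 0 ≤ r.2 :=
  (Measure.quasiMeasurePreserving_fst.ae (ae_rlMeasure_nonneg a)).and
    (Measure.quasiMeasurePreserving_snd.ae (ae_rlMeasure_nonneg b))

lemma rlMeasure₂_absolutelyContinuous {a b : ℝ} (ha : a ≠ 0) (hb : b ≠ 0) :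
    rlMeasure₂ a b ≪ volume :=
  (rlMeasure_absolutelyContinuous ha).prod (rlMeasure_absolutelyContinuous hb)

/-- The two-dimensional Riemann-Liouville integral on the whole plane. -/
def rl (a b : ℝ) (F : ℝ × ℝ → ℝ) (t : ℝ × ℝ) : ℝ := ∫ r, F (t - r) ∂rlMeasure₂ a b

/-- The semigroup law for integrals. Including order zero as a Dirac mass lets the cases β = 0 and β
= 1 be treated with the others. -/
lemma rl_rl {a b c e : ℝ} (ha : 0 ≤ a) (hb : 0 ≤ b) (hc : 0 ≤ c) (he : 0 ≤ e)
    {F : ℝ × ℝ → ℝ} {t : ℝ × ℝ}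
    (hF : Integrable (fun r => F (t - r)) (rlMeasure₂ (a + c) (b + e))) :
    rl a b (rl c e F) t = rl (a + c) (b + e) F t := by
  rw [← rlMeasure₂_conv ha hb hc he] at hF
  unfold rl
  rw [← rlMeasure₂_conv ha hb hc he, integral_conv hF]
  simp_rw [sub_sub]

lemma rl_congr {a b : ℝ} {F G : ℝ × ℝ → ℝ} {t : ℝ × ℝ}
    (h : ∀ x, x.1 ≤ t.1 → x.2 ≤ t.2 → F x = G x) : rl a b F t = rl a b G t := by
  refine integral_congr_ae ?_
  filter_upwards [ae_rlMeasure₂_nonneg a b] with r hr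
  exact h _ (by simpa using hr.1) (by simpa using hr.2)

/-! ### Causal functions. -/

/-- A function vanishing outside the quadrant `(c, ∞)²`. -/
def IsCausal (c : ℝ) (F : ℝ × ℝ → ℝ) : Prop := ∀ t, t.1 ≤ c ∨ t.2 ≤ c → F t = 0

lemma IsCausal.rl {c a b : ℝ} {F : ℝ × ℝ → ℝ} (hF : IsCausal c F) : IsCausal c (rl a b F) := by
  intro t ht
  rw [rl_congr (G := fun _ => 0)]
  · simp [HilferNehari.rl]
  · intro x h1 h2
    exact hF x (ht.imp h1.trans h2.trans)

lemma rlMeasure_Iic_lt_top {a : ℝ} (ha : 0 ≤ a) (R : ℝ) : rlMeasure a (Iic R) < ⊤ := by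
  rcases ha.eq_or_lt with rfl | ha
  · rw [rlMeasure_zero]; exact measure_lt_top _ _
  rw [rlMeasure_of_ne ha.ne', withDensity_apply _ measurableSet_Iic]
  have hI : IntegrableOn (rlDensity a) (Iic R) := by
    have h1 : IntegrableOn (fun r : ℝ => r ^ (a - 1) / Real.Gamma a) (Ioc 0 R) := by
      rcases le_or_gt R 0 with h | h
      · simp [Ioc_eq_empty (not_lt.2 h)]
      · exact ((intervalIntegrable_iff_integrableOn_Ioc_of_le h.le).1
          (intervalIntegral.intervalIntegrable_rpow' (by linarith))).div_const _
    have h2 : rlDensity a = (Ioi 0).indicator fun r => r ^ (a - 1) / Real.Gamma a := by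
      ext r; simp [rlDensity, indicator]
    rw [h2, IntegrableOn, integrable_indicator_iff measurableSet_Ioi, IntegrableOn,
      Measure.restrict_restrict measurableSet_Ioi, Ioi_inter_Iic]
    exact h1
  exact (hasFiniteIntegral_iff_ofReal (ae_of_all _ (rlDensity_nonneg ha.le))).1 hI.2

lemma rlMeasure₂_Iic_lt_top {a b : ℝ} (ha : 0 ≤ a) (hb : 0 ≤ b) (R : ℝ) :
    rlMeasure₂ a b (Iic R ×ˢ Iic R) < ⊤ := by
  rw [rlMeasure₂, Measure.prod_prod]
  exact ENNReal.mul_lt_top (rlMeasure_Iic_lt_top ha R) (rlMeasure_Iic_lt_top hb R)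

/-- Continuous causal functions are integrable against the Riemann-Liouville kernels. -/
lemma IsCausal.integrable_of_continuous {c a b : ℝ} {F : ℝ × ℝ → ℝ} (hF : IsCausal c F)
    (hc : Continuous F) (ha : 0 ≤ a) (hb : 0 ≤ b) (t : ℝ × ℝ) :
    Integrable (fun r => F (t - r)) (rlMeasure₂ a b) := by
  obtain ⟨C, hC⟩ := (isCompact_Icc.prod isCompact_Icc :
    IsCompact (Icc c t.1 ×ˢ Icc c t.2)).exists_bound_of_continuousOn hc.continuousOn
  set R := max (t.1 - c) (t.2 - c)
  have hI : Integrable ((Iic R ×ˢ Iic R).indicator fun _ : ℝ × ℝ => C) (rlMeasure₂ a b) :=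
    (integrable_indicator_iff (measurableSet_Iic.prod measurableSet_Iic)).2
      (integrableOn_const (rlMeasure₂_Iic_lt_top ha hb R).ne)
  refine hI.norm.mono' (by fun_prop) ?_
  filter_upwards [ae_rlMeasure₂_nonneg a b] with r hr
  by_cases hz : (t - r).1 ≤ c ∨ (t - r).2 ≤ c
  · rw [hF _ hz, norm_zero]
    exact norm_nonneg _
  · rw [not_or, not_le, not_le, Prod.fst_sub, Prod.snd_sub] at hz
    have h1 : t.1 - c ≤ R := le_max_left _ _
    have h2 : t.2 - c ≤ R := le_max_right _ _
    have hr' : r ∈ Iic R ×ˢ Iic R :=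
      ⟨by simp only [mem_Iic]; linarith, by simp only [mem_Iic]; linarith⟩
    rw [indicator_of_mem hr']
    refine (hC _ ⟨⟨?_, ?_⟩, ?_, ?_⟩).trans (le_abs_self _) <;>
      simp only [Prod.fst_sub, Prod.snd_sub] <;> linarith

/-- Dominated convergence: for t within distance 1 of t₀, causality confines the integrand to a
fixed box r₁, r₂ ≤ R, which has finite measure. -/
lemma IsCausal.continuous_rl {c a b C : ℝ} {F : ℝ × ℝ → ℝ} (hF : IsCausal c F)
    (hc : Continuous F) (hC : ∀ t, |F t| ≤ C) (ha : 0 ≤ a) (hb : 0 ≤ b) :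
    Continuous (HilferNehari.rl a b F) := by
  rw [continuous_iff_continuousAt]
  intro t₀
  set R := max (t₀.1 + 1 - c) (t₀.2 + 1 - c)
  have hI : Integrable ((Iic R ×ˢ Iic R).indicator fun _ : ℝ × ℝ => C) (rlMeasure₂ a b) :=
    (integrable_indicator_iff (measurableSet_Iic.prod measurableSet_Iic)).2
      (integrableOn_const (rlMeasure₂_Iic_lt_top ha hb R).ne)
  refine continuousAt_of_dominated (bound := (Iic R ×ˢ Iic R).indicator fun _ => C)
    (Eventually.of_forall fun t => by fun_prop) ?_ hI
    (ae_of_all _ fun r => by fun_prop)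
  have hU : ∀ᶠ t in 𝓝 t₀, t.1 < t₀.1 + 1 ∧ t.2 < t₀.2 + 1 :=
    (continuous_fst.continuousAt.eventually_lt continuousAt_const (by simp)).and
      (continuous_snd.continuousAt.eventually_lt continuousAt_const (by simp))
  filter_upwards [hU] with t ht
  refine ae_of_all _ fun r => ?_
  by_cases hr : r ∈ Iic R ×ˢ Iic R
  · rw [indicator_of_mem hr]; exact hC _
  · rw [indicator_of_notMem hr, hF _ ?_, norm_zero]
    simp only [mem_prod, mem_Iic, not_and_or, not_le] at hr
    have h1 : t₀.1 + 1 - c ≤ R := le_max_left _ _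
    have h2 : t₀.2 + 1 - c ≤ R := le_max_right _ _
    simp only [Prod.fst_sub, Prod.snd_sub]
    rcases hr with h | h
    · left; linarith [ht.1]
    · right; linarith [ht.2]

/-! ### The change of coordinates by χ. -/

/-- The open square `(0,T)²`. -/
def openSquare (T : ℝ) : Set (ℝ × ℝ) := Ioo 0 T ×ˢ Ioo 0 T

lemma measurableSet_openSquare (T : ℝ) : MeasurableSet (openSquare T) :=
  measurableSet_Ioo.prod measurableSet_Ioo

lemma measurableSet_square (T : ℝ) : MeasurableSet (square T) :=
  measurableSet_Icc.prod measurableSet_Icc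

lemma openSquare_subset_square (T : ℝ) : openSquare T ⊆ square T :=
  prod_mono Ioo_subset_Icc_self Ioo_subset_Icc_self

lemma openSquare_ae_eq_square (T : ℝ) : (openSquare T : Set (ℝ × ℝ)) =ᵐ[volume] square T :=
  Measure.set_prod_ae_eq Ioo_ae_eq_Icc Ioo_ae_eq_Icc

lemma restrict_openSquare (T : ℝ) :
    (volume : Measure (ℝ × ℝ)).restrict (openSquare T) = volume.restrict (square T) :=
  Measure.restrict_congr_set (openSquare_ae_eq_square T)

/-- A `C¹` diffeomorphism of the line extending `χ` from `[0,T]`. -/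
structure ChiExt (T : ℝ) (χ : ℝ → ℝ) where
  X : ℝ ≃o ℝ
  d : ℝ → ℝ
  D : ℝ
  hasDerivAt : ∀ x, HasDerivAt X (d x) x
  continuous_d : Continuous d
  d_pos : ∀ x, 0 < d x
  d_le : ∀ x, d x ≤ D
  eq_chi : ∀ x ∈ Icc 0 T, χ x = X x
  eq_dchi : ∀ x ∈ Icc 0 T, dchi T χ x = d x

/-- Extend χ' by its end values to the whole line and integrate. By compactness χ' has a positive
minimum, so the primitive grows at least linearly and is onto. -/
lemma exists_chiExt {T : ℝ} (hT : 0 < T) {χ : ℝ → ℝ} (hχ : ContDiffOn ℝ 1 χ (Icc 0 T))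
    (hχmono : MonotoneOn χ (Icc 0 T))
    (hχ' : ∀ x ∈ Icc 0 T, derivWithin χ (Icc 0 T) x ≠ 0) : Nonempty (ChiExt T χ) := by
  have hc : ContinuousOn (dchi T χ) (Icc 0 T) :=
    hχ.continuousOn_derivWithin (uniqueDiffOn_Icc hT) le_rfl
  have hpos : ∀ x ∈ Icc 0 T, 0 < dchi T χ x := fun x hx =>
    lt_of_le_of_ne hχmono.derivWithin_nonneg (hχ' x hx).symm
  set d : ℝ → ℝ := IccExtend hT.le ((Icc 0 T).domRestrict (dchi T χ))
  have hdc : Continuous d := (continuousOn_iff_continuous_domRestrict.1 hc).Icc_extend'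
  have hdeq : ∀ x ∈ Icc 0 T, d x = dchi T χ x := fun x hx => by
    simp only [d]; rw [IccExtend_of_mem _ _ hx]; rfl
  obtain ⟨x₁, hx₁, hmin⟩ := isCompact_Icc.exists_isMinOn (nonempty_Icc.2 hT.le) hc
  obtain ⟨x₂, hx₂, hmax⟩ := isCompact_Icc.exists_isMaxOn (nonempty_Icc.2 hT.le) hc
  have hlow : ∀ x, dchi T χ x₁ ≤ d x := fun x => hmin (projIcc 0 T hT.le x).2
  have hup : ∀ x, d x ≤ dchi T χ x₂ := fun x => hmax (projIcc 0 T hT.le x).2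
  set m := dchi T χ x₁
  have hm : 0 < m := hpos x₁ hx₁
  set Y : ℝ → ℝ := fun x => χ 0 + ∫ s in (0 : ℝ)..x, d s
  have hY : ∀ x, HasDerivAt Y (d x) x := fun x =>
    (intervalIntegral.integral_hasDerivAt_right (hdc.intervalIntegrable _ _)
      (hdc.stronglyMeasurableAtFilter _ _) hdc.continuousAt).const_add _
  have hYm : StrictMono Y := strictMono_of_hasDerivAt_pos hY fun x => hm.trans_le (hlow x)
  have hYc : Continuous Y := continuous_iff_continuousAt.2 fun x => (hY x).continuousAt
  have hgrow : Monotone fun x => Y x - m * x := by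
    have h : ∀ x, HasDerivAt (fun x => Y x - m * x) (d x - m) x := fun x =>
      ((hY x).sub ((hasDerivAt_id x).const_mul m)).congr_deriv (by simp)
    exact monotone_of_deriv_nonneg (fun x => (h x).differentiableAt) fun x => by
      rw [(h x).deriv]; linarith [hlow x]
  have hYs : Function.Surjective Y := by
    refine hYc.surjective ?_ ?_
    · refine tendsto_atTop_mono' _ ?_ ((tendsto_id.const_mul_atTop hm).atTop_add
        (tendsto_const_nhds (x := Y 0)))
      filter_upwards [eventually_ge_atTop 0] with x hx
      have := hgrow hx
      simp only [mul_zero, sub_zero, id] at this ⊢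
      linarith
    · refine tendsto_atBot_mono' _ ?_ ((tendsto_id.const_mul_atBot hm).atBot_add
        (tendsto_const_nhds (x := Y 0)))
      filter_upwards [eventually_le_atBot 0] with x hx
      have := hgrow hx
      simp only [mul_zero, sub_zero, id] at this ⊢
      linarith
  refine ⟨⟨hYm.orderIsoOfSurjective Y hYs, d, dchi T χ x₂, hY, hdc,
    fun x => hm.trans_le (hlow x), hup, fun x hx => ?_, fun x hx => (hdeq x hx).symm⟩⟩
  have hsub : Icc 0 x ⊆ Icc 0 T := Icc_subset_Icc_right hx.2
  have := intervalIntegral.integral_eq_sub_of_hasDerivAt_of_le (f := χ) (f' := d) hx.1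
    (hχ.continuousOn.mono hsub) (fun y hy => ?_) (hdc.intervalIntegrable _ _)
  · change χ x = χ 0 + ∫ s in (0 : ℝ)..x, d s
    rw [this]; ring
  · have hyT : y ∈ Ioo 0 T := ⟨hy.1, hy.2.trans_le hx.2⟩
    rw [hdeq y (Ioo_subset_Icc_self hyT)]
    exact ((hχ.differentiableOn one_ne_zero).differentiableAt
      (Icc_mem_nhds hyT.1 hyT.2)).hasDerivAt.congr_deriv
      (derivWithin_of_mem_nhds (Icc_mem_nhds hyT.1 hyT.2)).symm

namespace ChiExt

variable {T : ℝ} {χ : ℝ → ℝ} (E : ChiExt T χ)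

/-- The coordinates `(χ(ξ₁), χ(ξ₂))`. -/
def XX : ℝ × ℝ ≃ₜ ℝ × ℝ := E.X.toHomeomorph.prodCongr E.X.toHomeomorph

@[simp] lemma XX_fst (ξ : ℝ × ℝ) : (E.XX ξ).1 = E.X ξ.1 := rfl

@[simp] lemma XX_snd (ξ : ℝ × ℝ) : (E.XX ξ).2 = E.X ξ.2 := rfl

@[simp] lemma XX_symm_fst (t : ℝ × ℝ) : (E.XX.symm t).1 = E.X.symm t.1 := rfl

@[simp] lemma XX_symm_snd (t : ℝ × ℝ) : (E.XX.symm t).2 = E.X.symm t.2 := rfl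

lemma image_X_univ : E.X '' univ = univ := image_univ_of_surjective E.X.surjective

lemma D_pos : 0 < E.D := (E.d_pos 0).trans_le (E.d_le 0)

lemma map_symm_volume :
    Measure.map E.X.symm volume = volume.withDensity fun s => ENNReal.ofReal (E.d s) := by
  have hmeas : Measurable E.X.symm := E.X.symm.continuous.measurable
  refine Measure.ext_of_lintegral _ fun f hf => ?_
  rw [lintegral_map hf hmeas, lintegral_withDensity_eq_lintegral_mul _
    (E.continuous_d.measurable.ennreal_ofReal) hf]
  have := lintegral_image_eq_lintegral_abs_deriv_mul MeasurableSet.univ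
    (fun x _ => (E.hasDerivAt x).hasDerivWithinAt) E.X.injective.injOn (fun t => f (E.X.symm t))
  rw [image_X_univ, Measure.restrict_univ] at this
  rw [this]
  refine lintegral_congr fun s => ?_
  simp [abs_of_pos (E.d_pos s)]

lemma map_XX_symm_volume :
    Measure.map E.XX.symm volume =
      volume.withDensity fun s => ENNReal.ofReal (E.d s.1) * ENNReal.ofReal (E.d s.2) := by
  have hmeas : Measurable E.X.symm := E.X.symm.continuous.measurable
  have hd := E.continuous_d.measurable.ennreal_ofReal
  have h : (E.XX.symm : ℝ × ℝ → ℝ × ℝ) = Prod.map E.X.symm E.X.symm := rfl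
  have hsf : SFinite (Measure.map E.X.symm volume) := inferInstance
  rw [h, Measure.volume_eq_prod, ← Measure.map_prod_map _ _ hmeas hmeas, map_symm_volume,
    prod_withDensity hd hd]

lemma map_XX_symm_volume_le :
    Measure.map E.XX.symm volume ≤ ENNReal.ofReal (E.D ^ 2) • (volume : Measure (ℝ × ℝ)) := by
  rw [map_XX_symm_volume, ← withDensity_const]
  refine withDensity_mono (ae_of_all _ fun s => ?_)
  simp only
  rw [← ENNReal.ofReal_mul (E.d_pos _).le]
  refine ENNReal.ofReal_le_ofReal ?_
  rw [sq]
  exact mul_le_mul (E.d_le _) (E.d_le _) (E.d_pos _).le E.D_pos.le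

lemma quasiMeasurePreserving_XX_symm :
    Measure.QuasiMeasurePreserving E.XX.symm volume volume := by
  refine ⟨E.XX.symm.continuous.measurable, ?_⟩
  rw [map_XX_symm_volume]
  exact withDensity_absolutelyContinuous _ _

lemma quasiMeasurePreserving_XX : Measure.QuasiMeasurePreserving E.XX volume volume := by
  refine ⟨E.XX.continuous.measurable, ?_⟩
  have hd := E.continuous_d.measurable.ennreal_ofReal
  have h : (volume : Measure (ℝ × ℝ)) ≪ Measure.map E.XX.symm volume := by
    rw [map_XX_symm_volume]
    refine withDensity_absolutelyContinuous'
      ((hd.comp measurable_fst).mul (hd.comp measurable_snd)).aemeasurable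
      (ae_of_all _ fun s => ?_)
    exact mul_ne_zero (ENNReal.ofReal_pos.2 (E.d_pos _)).ne' (ENNReal.ofReal_pos.2 (E.d_pos _)).ne'
  have h2 := h.map E.XX.continuous.measurable
  rwa [Measure.map_map E.XX.continuous.measurable E.XX.symm.continuous.measurable,
    E.XX.self_comp_symm, Measure.map_id] at h2

/-- Substituting t = χ(s) absorbs the weight χ'. The integral over the whole line reduces to (0, x):
for s ≤ 0 the function F vanishes, and for s ≥ x the density does. -/
lemma fracInt₁_eq {a x : ℝ} (ha : 0 ≤ a) (hx : x ∈ Ioc 0 T) {f F : ℝ → ℝ}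
    (hf : ∀ s ∈ Ioc 0 x, f s = F (E.X s)) (hF : ∀ t ≤ E.X 0, F t = 0) :
    fracInt₁ T χ a f x = ∫ r, F (E.X x - r) ∂rlMeasure a := by
  unfold fracInt₁
  split_ifs with h
  · rw [h, rlMeasure_zero, integral_dirac, sub_zero, hf x ⟨hx.1, le_rfl⟩]
  rw [rlMeasure_of_ne h, integral_withDensity_eq_integral_toReal_smul
    (measurable_rlDensity a).ennreal_ofReal (by simp)]
  simp_rw [ENNReal.toReal_ofReal (rlDensity_nonneg ha _), smul_eq_mul]
  have h1 := integral_sub_left_eq_self (fun t => rlDensity a (E.X x - t) * F t) volume (E.X x)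
  simp only [sub_sub_cancel] at h1
  have h2 := integral_image_eq_integral_abs_deriv_smul MeasurableSet.univ
    (fun x _ => (E.hasDerivAt x).hasDerivWithinAt) E.X.injective.injOn
    (fun t => rlDensity a (E.X x - t) * F t)
  rw [image_X_univ, Measure.restrict_univ] at h2
  rw [h1, h2, intervalIntegral.integral_of_le hx.1.le, integral_Ioc_eq_integral_Ioo,
    ← integral_const_mul, ← integral_indicator measurableSet_Ioo]
  refine integral_congr_ae (ae_of_all _ fun s => ?_)
  by_cases hs : s ∈ Ioo 0 x
  · have hsT : s ∈ Icc 0 T := ⟨hs.1.le, hs.2.le.trans hx.2⟩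
    have hlt : 0 < E.X x - E.X s := sub_pos.2 (E.X.strictMono hs.2)
    simp only [indicator_of_mem hs, abs_of_pos (E.d_pos s), smul_eq_mul, rlDensity, hlt, if_true,
      E.eq_dchi s hsT, E.eq_chi s hsT, E.eq_chi x ⟨hx.1.le, hx.2⟩, hf s ⟨hs.1, hs.2.le⟩]
    ring
  · simp only [indicator_of_notMem hs]
    rw [mem_Ioo, not_and_or, not_lt, not_lt] at hs
    rcases hs with hs | hs
    · simp [hF _ (E.X.monotone hs)]
    · have : ¬ 0 < E.X x - E.X s := by
        have := E.X.monotone hs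
        linarith
      simp [rlDensity, this]

lemma fracInt_eq {a b : ℝ} (ha : 0 ≤ a) (hb : 0 ≤ b) {ξ : ℝ × ℝ} (hξ : ξ ∈ openSquare T)
    {f F : ℝ × ℝ → ℝ} (hf : ∀ z ∈ Ioc 0 ξ.1 ×ˢ Ioc 0 ξ.2, f z = F (E.XX z))
    (hF : IsCausal (E.X 0) F)
    (hi : Integrable (fun r => F (E.XX ξ - r)) (rlMeasure₂ a b)) :
    fracInt T χ a b f ξ = rl a b F (E.XX ξ) := by
  unfold fracInt rl
  rw [E.fracInt₁_eq ha ⟨hξ.1.1, hξ.1.2.le⟩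
    (F := fun t₁ => ∫ r, F (t₁, E.X ξ.2 - r) ∂rlMeasure b) (fun x hx => ?_) (fun t ht => ?_)]
  · rw [rlMeasure₂, integral_prod _ hi]
    rfl
  · exact E.fracInt₁_eq hb ⟨hξ.2.1, hξ.2.2.le⟩ (F := fun t => F (E.X x, t))
      (fun y hy => hf (x, y) ⟨hx, hy⟩) fun t ht => hF _ (Or.inr ht)
  · have : ∀ r, F (t, E.X ξ.2 - r) = 0 := fun r => hF _ (Or.inl ht)
    simp [this]

/-- The extension by zero of a function on the open square, in the coordinates `χ(ξ₁), χ(ξ₂)`. -/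
def lift (g : ℝ × ℝ → ℝ) (t : ℝ × ℝ) : ℝ := (openSquare T).indicator g (E.XX.symm t)

lemma isCausal_lift (g : ℝ × ℝ → ℝ) : IsCausal (E.X 0) (E.lift g) := by
  intro t ht
  refine indicator_of_notMem (fun h => ?_) _
  rcases ht with ht | ht
  · exact absurd ((OrderIso.symm_apply_le E.X).2 ht) (not_le.2 h.1.1)
  · exact absurd ((OrderIso.symm_apply_le E.X).2 ht) (not_le.2 h.2.1)

lemma lift_XX_of_mem {g : ℝ × ℝ → ℝ} {z : ℝ × ℝ} (hz : z ∈ openSquare T) :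
    E.lift g (E.XX z) = g z := by
  simp [lift, hz]

end ChiExt

/-! ### Mixed derivatives and test functions. -/

lemma intervalIntegral_swap_of_continuous {c : ℝ × ℝ → ℝ} (hc : Continuous c) {x y : ℝ}
    (hy : 0 ≤ y) :
    ∫ s in (0 : ℝ)..x, ∫ r in (0 : ℝ)..y, c (s, r) =
      ∫ r in (0 : ℝ)..y, ∫ s in (0 : ℝ)..x, c (s, r) := by
  simp_rw [intervalIntegral.integral_of_le hy]
  refine intervalIntegral_integral_swap ?_
  rw [Measure.prod_restrict]
  exact (hc.continuousOn.integrableOn_compact (isCompact_uIcc.prod isCompact_Icc)).mono_set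
    (prod_mono uIoc_subset_uIcc Ioc_subset_Icc_self)

lemma deriv_deriv_integral {T : ℝ} {c f : ℝ × ℝ → ℝ} (hc : Continuous c)
    (hf : ∀ z ∈ openSquare T, f z = ∫ s in (0 : ℝ)..z.1, ∫ r in (0 : ℝ)..z.2, c (s, r))
    {ξ : ℝ × ℝ} (hξ : ξ ∈ openSquare T) :
    deriv (fun x => deriv (fun y => f (x, y)) ξ.2) ξ.1 = c ξ := by
  have h1 : (fun x => deriv (fun y => f (x, y)) ξ.2) =ᶠ[𝓝 ξ.1]
      fun x => ∫ s in (0 : ℝ)..x, c (s, ξ.2) := by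
    filter_upwards [Ioo_mem_nhds hξ.1.1 hξ.1.2] with x hx
    have h2 : (fun y => f (x, y)) =ᶠ[𝓝 ξ.2]
        fun y => ∫ r in (0 : ℝ)..y, ∫ s in (0 : ℝ)..x, c (s, r) := by
      filter_upwards [Ioo_mem_nhds hξ.2.1 hξ.2.2] with y hy
      rw [hf (x, y) ⟨hx, hy⟩]
      exact intervalIntegral_swap_of_continuous hc hy.1.le
    have h3 : Continuous fun r => ∫ s in (0 : ℝ)..x, c (s, r) :=
      intervalIntegral.continuous_parametric_intervalIntegral_of_continuous'
        (f := fun r s => c (s, r)) (hc.comp continuous_swap) 0 x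
    rw [h2.deriv_eq]
    exact h3.deriv_integral _ 0 ξ.2
  rw [h1.deriv_eq]
  exact (hc.comp (Continuous.prodMk_left ξ.2)).deriv_integral _ 0 ξ.1

/-- The second mixed partial derivative of a smooth function. -/
def mixedPartial (u : ℝ × ℝ → ℝ) (z : ℝ × ℝ) : ℝ :=
  fderiv ℝ (fun z => fderiv ℝ u z (0, 1)) z (1, 0)

namespace IsTest

variable {T : ℝ} {u : ℝ × ℝ → ℝ}

lemma eq_zero_of_notMem (hu : IsTest T u) {z : ℝ × ℝ} (hz : z ∉ openSquare T) : u z = 0 :=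
  image_eq_zero_of_notMem_tsupport fun h => hz (hu.2.2 h)

lemma fderiv_eq_zero_of_notMem (hu : IsTest T u) {z : ℝ × ℝ} (hz : z ∉ openSquare T) :
    fderiv ℝ u z = 0 :=
  image_eq_zero_of_notMem_tsupport fun h => hz (hu.2.2 (tsupport_fderiv_subset ℝ h))

lemma tsupport_snd_subset (u : ℝ × ℝ → ℝ) :
    tsupport (fun z => fderiv ℝ u z (0, 1)) ⊆ tsupport u :=
  (closure_mono fun z (hz : _ ≠ _) => fun h => hz (by simp [h])).trans (tsupport_fderiv_subset ℝ)

lemma support_mixedPartial_subset (u : ℝ × ℝ → ℝ) :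
    Function.support (mixedPartial u) ⊆ tsupport u := fun z hz =>
  tsupport_snd_subset u (tsupport_fderiv_subset ℝ (subset_tsupport _ fun h => hz (by
    simp [mixedPartial, h])))

lemma contDiff_snd (hu : IsTest T u) : ContDiff ℝ ∞ fun z => fderiv ℝ u z (0, 1) :=
  (hu.1.fderiv_right (m := ∞) (by simp)).clm_apply contDiff_const

lemma continuous_mixedPartial (hu : IsTest T u) : Continuous (mixedPartial u) :=
  ((hu.contDiff_snd.continuous_fderiv (by simp)).clm_apply continuous_const)

/-- Two integrations leave no boundary terms, since u and its derivative vanish on the axes. -/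
lemma eq_integral_mixedPartial (hu : IsTest T u) {z : ℝ × ℝ} (hz : z ∈ openSquare T) :
    u z = ∫ s in (0 : ℝ)..z.1, ∫ r in (0 : ℝ)..z.2, mixedPartial u (s, r) := by
  rw [intervalIntegral_swap_of_continuous hu.continuous_mixedPartial hz.2.1.le]
  have h1 : ∀ r, ∫ s in (0 : ℝ)..z.1, mixedPartial u (s, r) = fderiv ℝ u (z.1, r) (0, 1) := by
    intro r
    have hd : ∀ s, HasDerivAt (fun s => fderiv ℝ u (s, r) (0, 1)) (mixedPartial u (s, r)) s :=
      fun s => HasFDerivAt.comp_hasDerivAt (l := fun z => fderiv ℝ u z (0, 1))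
        (f := fun s => (s, r)) s (hu.contDiff_snd.differentiable (by simp) (s, r)).hasFDerivAt
        ((hasDerivAt_id s).prodMk (hasDerivAt_const s r))
    rw [intervalIntegral.integral_eq_sub_of_hasDerivAt (fun s _ => hd s)
      ((hu.continuous_mixedPartial.comp (Continuous.prodMk_left r)).intervalIntegrable _ _),
      hu.fderiv_eq_zero_of_notMem (z := (0, r)) fun h => lt_irrefl _ h.1.1]
    simp
  simp_rw [h1]
  have hd : ∀ r, HasDerivAt (fun r => u (z.1, r)) (fderiv ℝ u (z.1, r) (0, 1)) r :=
    fun r => ((hu.1.differentiable (by simp) (z.1, r)).hasFDerivAt).comp_hasDerivAt r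
      ((hasDerivAt_const r z.1).prodMk (hasDerivAt_id r))
  rw [intervalIntegral.integral_eq_sub_of_hasDerivAt (fun r _ => hd r)
    ((hu.contDiff_snd.continuous.comp (Continuous.prodMk_right z.1)).intervalIntegrable _ _),
    hu.eq_zero_of_notMem (z := (z.1, 0)) fun h => lt_irrefl _ h.2.1]
  simp

end IsTest

/-! ### Inversion of the Hilfer derivative on test functions. -/

namespace ChiExt

variable {T : ℝ} {χ : ℝ → ℝ} (E : ChiExt T χ)

/-- Cutting F off outside the image of the square is invisible to integrals evaluated inside it,
which only see points to the lower left. -/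
lemma lift_eq_of_le {g F : ℝ × ℝ → ℝ} (hF : IsCausal (E.X 0) F)
    (hg : ∀ z ∈ openSquare T, g z = F (E.XX z)) {ξ : ℝ × ℝ} (hξ : ξ ∈ openSquare T)
    {t : ℝ × ℝ} (h1 : t.1 ≤ E.X ξ.1) (h2 : t.2 ≤ E.X ξ.2) : E.lift g t = F t := by
  by_cases ht : t.1 ≤ E.X 0 ∨ t.2 ≤ E.X 0
  · rw [hF t ht, E.isCausal_lift g t ht]
  · rw [not_or, not_le, not_le] at ht
    have hm : E.XX.symm t ∈ openSquare T :=
      ⟨⟨E.X.lt_symm_apply.2 ht.1, (E.X.symm_apply_le.2 h1).trans_lt hξ.1.2⟩,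
        E.X.lt_symm_apply.2 ht.2, (E.X.symm_apply_le.2 h2).trans_lt hξ.2.2⟩
    rw [lift, indicator_of_mem hm, hg _ hm, E.XX.apply_symm_apply]

lemma rl_one_one_eq {F : ℝ × ℝ → ℝ} (hF : IsCausal (E.X 0) F) (hc : Continuous F) {ξ : ℝ × ℝ}
    (hξ : ξ ∈ openSquare T) :
    rl 1 1 F (E.XX ξ) = ∫ s in (0 : ℝ)..ξ.1, ∫ r in (0 : ℝ)..ξ.2,
      E.d s * E.d r * F (E.XX (s, r)) := by
  rw [← E.fracInt_eq zero_le_one zero_le_one hξ (f := fun z => F (E.XX z)) (fun _ _ => rfl) hF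
    (hF.integrable_of_continuous hc zero_le_one zero_le_one _)]
  have hsub : ∀ {x : ℝ}, x ∈ Ioo 0 T → ∀ s ∈ uIcc 0 x, s ∈ Icc 0 T := fun hx s hs => by
    rw [uIcc_of_le hx.1.le] at hs
    exact ⟨hs.1, hs.2.trans hx.2.le⟩
  simp only [fracInt, fracInt₁, one_ne_zero, if_false, Real.Gamma_one, sub_self, Real.rpow_zero,
    div_one, one_mul, mul_one]
  refine intervalIntegral.integral_congr fun s hs => ?_
  rw [← intervalIntegral.integral_const_mul]
  refine intervalIntegral.integral_congr fun r hr => ?_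
  simp only [E.eq_dchi s (hsub hξ.1 s hs), E.eq_dchi r (hsub hξ.2 r hr), mul_assoc]

/-- The `χ`-Hilfer derivative of a test function is a Riemann-Liouville integral of its mixed
derivative, and is inverted by the Riemann-Liouville integral of order `(α₁, α₂)`. -/
lemma exists_hilfer_eq {α₁ α₂ β : ℝ} (hα₁ : α₁ < 1) (hα₂ : α₂ < 1) (hβ0 : 0 ≤ β) (hβ1 : β ≤ 1)
    {u : ℝ × ℝ → ℝ} (hu : IsTest T u) :
    ∃ V : ℝ × ℝ → ℝ, Continuous V ∧ IsCausal (E.X 0) V ∧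
      (∀ ξ ∈ openSquare T, u ξ = rl 1 1 V (E.XX ξ)) ∧
      ∀ ξ ∈ openSquare T, hilfer T χ α₁ α₂ β u ξ = rl (1 - α₁) (1 - α₂) V (E.XX ξ) := by
  -- `v` is the χ-weighted mixed derivative of u, and `V` below is the same function in the new
  -- coordinates.
  set v : ℝ × ℝ → ℝ := fun z => (E.d z.1 * E.d z.2)⁻¹ * mixedPartial u z
  have hdd : ∀ z : ℝ × ℝ, 0 < E.d z.1 * E.d z.2 := fun z => mul_pos (E.d_pos _) (E.d_pos _)
  have hdc : Continuous fun z : ℝ × ℝ => E.d z.1 * E.d z.2 :=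
    (E.continuous_d.comp continuous_fst).mul (E.continuous_d.comp continuous_snd)
  have hvc : Continuous v := (hdc.inv₀ fun z => (hdd z).ne').mul hu.continuous_mixedPartial
  have hvs : Function.support v ⊆ tsupport u := fun z hz =>
    IsTest.support_mixedPartial_subset u fun h => hz (by simp [v, h])
  have hvcs : HasCompactSupport v := hu.2.1.mono' hvs
  obtain ⟨C, hC⟩ := hvc.bounded_above_of_compact_support hvcs
  set V : ℝ × ℝ → ℝ := fun t => v (E.XX.symm t)
  have hVc : Continuous V := hvc.comp E.XX.symm.continuous
  have hV : IsCausal (E.X 0) V := by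
    intro t ht
    by_contra h
    have hm : E.XX.symm t ∈ openSquare T := hu.2.2 (hvs h)
    rcases ht with ht | ht
    · exact absurd (E.X.symm_apply_le.2 ht) (not_le.2 hm.1.1)
    · exact absurd (E.X.symm_apply_le.2 ht) (not_le.2 hm.2.1)
  have hVC : ∀ t, |V t| ≤ C := fun t => hC _
  have hu1 : ∀ ξ ∈ openSquare T, u ξ = rl 1 1 V (E.XX ξ) := fun ξ hξ => by
    rw [hu.eq_integral_mixedPartial hξ, E.rl_one_one_eq hV hVc hξ]
    simp only [V, v, E.XX.symm_apply_apply]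
    refine intervalIntegral.integral_congr fun s _ => intervalIntegral.integral_congr fun r _ => ?_
    rw [mul_inv_cancel_left₀ (hdd (s, r)).ne']
  refine ⟨V, hVc, hV, hu1, fun ξ hξ => ?_⟩
  have hc₁ : 0 ≤ 1 - α₁ := by linarith
  have hc₂ : 0 ≤ 1 - α₂ := by linarith
  set b₁ := (1 - β) * (1 - α₁)
  set b₂ := (1 - β) * (1 - α₂)
  have hb₁ : 0 ≤ b₁ := mul_nonneg (by linarith) hc₁
  have hb₂ : 0 ≤ b₂ := mul_nonneg (by linarith) hc₂
  set W := rl b₁ b₂ V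
  have hWc : Continuous W := hV.continuous_rl hVc hVC hb₁ hb₂
  have hW : IsCausal (E.X 0) W := hV.rl
  have hmem : ∀ {ξ : ℝ × ℝ}, ξ ∈ openSquare T → ∀ z ∈ Ioc 0 ξ.1 ×ˢ Ioc 0 ξ.2,
      z ∈ openSquare T := fun hξ z hz =>
    ⟨⟨hz.1.1, hz.1.2.trans_lt hξ.1.2⟩, hz.2.1, hz.2.2.trans_lt hξ.2.2⟩
  -- Commuting the orders, I^b u = I^b I^1 V = I^1 I^b V = I^1 W. The mixed derivative then cancels
  -- I^1 and leaves the continuous function W.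
  have h1 : ∀ z ∈ openSquare T, fracInt T χ b₁ b₂ u z = ∫ s in (0 : ℝ)..z.1,
      ∫ r in (0 : ℝ)..z.2, E.d s * E.d r * W (E.XX (s, r)) := fun z hz => by
    rw [E.fracInt_eq hb₁ hb₂ hz (F := rl 1 1 V) (fun z' hz' => hu1 z' (hmem hz z' hz')) hV.rl
      (hV.rl.integrable_of_continuous (hV.continuous_rl hVc hVC zero_le_one zero_le_one)
        hb₁ hb₂ _), rl_rl hb₁ hb₂ zero_le_one zero_le_one
      (hV.integrable_of_continuous hVc (by linarith) (by linarith) _), add_comm b₁, add_comm b₂,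
      ← rl_rl zero_le_one zero_le_one hb₁ hb₂
      (hV.integrable_of_continuous hVc (by linarith) (by linarith) _),
      E.rl_one_one_eq hW hWc hz]
  have h2 : ∀ z ∈ openSquare T, mixedDeriv T χ (fracInt T χ b₁ b₂ u) z = W (E.XX z) :=
    fun z hz => by
      have hz' := openSquare_subset_square T hz
      rw [mixedDeriv, deriv_deriv_integral (c := fun z => E.d z.1 * E.d z.2 * W (E.XX z))
        (hdc.mul (hWc.comp E.XX.continuous)) h1 hz, E.eq_dchi _ hz'.1, E.eq_dchi _ hz'.2,
        one_div, inv_mul_cancel_left₀ (hdd z).ne']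
  have ha₁ : 0 ≤ β * (1 - α₁) := mul_nonneg hβ0 hc₁
  have ha₂ : 0 ≤ β * (1 - α₂) := mul_nonneg hβ0 hc₂
  rw [hilfer, E.fracInt_eq ha₁ ha₂ hξ (F := W) (fun z hz => h2 z (hmem hξ z hz)) hW
    (hW.integrable_of_continuous hWc ha₁ ha₂ _), rl_rl ha₁ ha₂ hb₁ hb₂
    (hV.integrable_of_continuous hVc (by linarith) (by linarith) _)]
  congr 1 <;> ring

/-- With 𝔇u = I^{1-α}V, this is I^α I^{1-α}V = I^1 V = u; the type β has dropped out. -/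
lemma rl_lift_hilfer {α₁ α₂ β : ℝ} (h₁ : 0 ≤ α₁) (h₂ : 0 ≤ α₂) (hα₁ : α₁ < 1) (hα₂ : α₂ < 1)
    (hβ0 : 0 ≤ β) (hβ1 : β ≤ 1) {u : ℝ × ℝ → ℝ} (hu : IsTest T u) {ξ : ℝ × ℝ}
    (hξ : ξ ∈ openSquare T) :
    rl α₁ α₂ (E.lift (hilfer T χ α₁ α₂ β u)) (E.XX ξ) = u ξ := by
  obtain ⟨V, hVc, hV, hu1, hDu⟩ := E.exists_hilfer_eq hα₁ hα₂ hβ0 hβ1 hu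
  rw [rl_congr (G := rl (1 - α₁) (1 - α₂) V) fun x h1 h2 => E.lift_eq_of_le hV.rl hDu hξ h1 h2,
    rl_rl h₁ h₂ (by linarith) (by linarith)
      (hV.integrable_of_continuous hVc (by linarith) (by linarith) _), hu1 ξ hξ]
  congr 1 <;> ring

end ChiExt

/-! ### Variable exponent spaces and Luxemburg norms. -/

section

/-- A measurable exponent with `1 < p ≤ γ ≤ P` almost everywhere on the square. -/
structure IsExponent (T : ℝ) (γ : ℝ × ℝ → ℝ) (p P : ℝ) : Prop where
  aemeasurable : AEMeasurable γ (volume.restrict (square T))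
  one_lt : 1 < p
  le : ∀ᵐ ξ ∂volume.restrict (square T), p ≤ γ ξ
  ge : ∀ᵐ ξ ∂volume.restrict (square T), γ ξ ≤ P

/-- `k` is admissible in the definition of the Luxemburg norm of `g`. -/
def Admissible (T : ℝ) (γ g : ℝ × ℝ → ℝ) (k : ℝ) : Prop :=
  0 < k ∧ IntegrableOn (fun ξ => |g ξ / k| ^ γ ξ) (square T) ∧
    ∫ ξ in square T, |g ξ / k| ^ γ ξ ≤ 1

lemma volume_square_lt_top (T : ℝ) : volume (square T) < ⊤ :=
  (isCompact_Icc.prod isCompact_Icc).measure_lt_top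

instance (T : ℝ) : IsFiniteMeasure (volume.restrict (square T)) :=
  ⟨by rw [Measure.restrict_apply_univ]; exact volume_square_lt_top T⟩

variable {T : ℝ} {γ f g : ℝ × ℝ → ℝ} {p P k : ℝ}

lemma IsExponent.aestronglyMeasurable_rpow (h : IsExponent T γ p P)
    (hf : AEStronglyMeasurable f (volume.restrict (square T))) :
    AEStronglyMeasurable (fun ξ => |f ξ| ^ γ ξ) (volume.restrict (square T)) :=
  (hf.norm.aemeasurable.pow h.aemeasurable).aestronglyMeasurable

lemma abs_rpow_nonneg (x y : ℝ) : 0 ≤ |x| ^ y := Real.rpow_nonneg (abs_nonneg x) y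

lemma MemLVar.of_bounded {C : ℝ} (h : IsExponent T γ p P)
    (hf : AEStronglyMeasurable f (volume.restrict (square T)))
    (hC : ∀ᵐ ξ ∂volume.restrict (square T), |f ξ| ≤ C) : MemLVar T γ f := by
  refine ⟨hf, Integrable.mono' (integrable_const ((1 + |C|) ^ P))
    (h.aestronglyMeasurable_rpow hf) ?_⟩
  filter_upwards [hC, h.le, h.ge] with ξ h1 h2 h3
  rw [Real.norm_of_nonneg (abs_rpow_nonneg _ _)]
  have h0 : |f ξ| ≤ 1 + |C| := by linarith [le_abs_self C]
  exact (Real.rpow_le_rpow (abs_nonneg _) h0 (by linarith [h.one_lt])).trans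
    (Real.rpow_le_rpow_of_exponent_le (by linarith [abs_nonneg C]) h3)

lemma MemLVar.const_mul (h : IsExponent T γ p P) (hf : MemLVar T γ f) (c : ℝ) :
    MemLVar T γ fun ξ => c * f ξ := by
  have hm := hf.1.const_mul c
  refine ⟨hm, Integrable.mono' (hf.2.const_mul ((1 + |c|) ^ P))
    (h.aestronglyMeasurable_rpow hm) ?_⟩
  filter_upwards [h.le, h.ge] with ξ h2 h3
  rw [Real.norm_of_nonneg (abs_rpow_nonneg _ _), abs_mul,
    Real.mul_rpow (abs_nonneg _) (abs_nonneg _)]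
  refine mul_le_mul_of_nonneg_right ?_ (abs_rpow_nonneg _ _)
  exact (Real.rpow_le_rpow (abs_nonneg _) (by linarith) (by linarith [h.one_lt])).trans
    (Real.rpow_le_rpow_of_exponent_le (by linarith [abs_nonneg c]) h3)

lemma MemLVar.div_const (h : IsExponent T γ p P) (hf : MemLVar T γ f) (c : ℝ) :
    MemLVar T γ fun ξ => f ξ / c := by
  simpa only [div_eq_inv_mul] using hf.const_mul h c⁻¹

lemma MemLVar.sub (h : IsExponent T γ p P) (hf : MemLVar T γ f) (hg : MemLVar T γ g) :
    MemLVar T γ (f - g) := by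
  have hm := hf.1.sub hg.1
  have hf2 := hf.const_mul h 2
  have hg2 := hg.const_mul h 2
  refine ⟨hm, Integrable.mono' (hf2.2.add hg2.2) (h.aestronglyMeasurable_rpow hm) ?_⟩
  filter_upwards [h.le] with ξ h2
  have hγ : 0 ≤ γ ξ := by linarith [h.one_lt]
  rw [Real.norm_of_nonneg (abs_rpow_nonneg _ _), Pi.add_apply, Pi.sub_apply]
  have h0 : |f ξ - g ξ| ≤ |f ξ| + |g ξ| := abs_sub _ _
  rcases le_total (|f ξ|) (|g ξ|) with hc | hc
  · refine (Real.rpow_le_rpow (abs_nonneg _) (show _ ≤ |2 * g ξ| by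
      rw [abs_mul, abs_two]; linarith) hγ).trans (le_add_of_nonneg_left (abs_rpow_nonneg _ _))
  · refine (Real.rpow_le_rpow (abs_nonneg _) (show _ ≤ |2 * f ξ| by
      rw [abs_mul, abs_two]; linarith) hγ).trans (le_add_of_nonneg_right (abs_rpow_nonneg _ _))

lemma IsTest.memLVar (h : IsExponent T γ p P) (hu : IsTest T f) : MemLVar T γ f := by
  obtain ⟨C, hC⟩ := hu.1.continuous.bounded_above_of_compact_support hu.2.1
  exact MemLVar.of_bounded h hu.1.continuous.aestronglyMeasurable (ae_of_all _ hC)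

lemma exists_graph_admissible (h : IsExponent T γ p P) (hf : MemLVar T γ f)
    (hg : MemLVar T γ g) :
    ∃ k : ℝ, 0 < k ∧ IntegrableOn (fun ξ => |f ξ / k| ^ γ ξ + |g ξ / k| ^ γ ξ) (square T) ∧
      ∫ ξ in square T, (|f ξ / k| ^ γ ξ + |g ξ / k| ^ γ ξ) ≤ 1 := by
  set I := ∫ ξ in square T, (|f ξ| ^ γ ξ + |g ξ| ^ γ ξ)
  -- Since k ≥ 1 and γ ≥ 1, dividing by k shrinks the modular at least by the factor k, and k ≥ I
  -- brings it down to at most 1.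
  set k := max 1 I
  have hk1 : 1 ≤ k := le_max_left _ _
  have hk0 : 0 < k := one_pos.trans_le hk1
  have hint : IntegrableOn (fun ξ => |f ξ / k| ^ γ ξ + |g ξ / k| ^ γ ξ) (square T) :=
    (hf.div_const h k).2.add (hg.div_const h k).2
  refine ⟨k, hk0, hint, ?_⟩
  have key : ∀ x y : ℝ, 1 ≤ y → |x / k| ^ y ≤ |x| ^ y / k := fun x y hy => by
    rw [abs_div, abs_of_pos hk0, Real.div_rpow (abs_nonneg _) hk0.le]
    refine div_le_div_of_nonneg_left (abs_rpow_nonneg _ _) hk0 ?_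
    simpa using Real.rpow_le_rpow_of_exponent_le hk1 hy
  calc ∫ ξ in square T, (|f ξ / k| ^ γ ξ + |g ξ / k| ^ γ ξ)
      ≤ ∫ ξ in square T, (|f ξ| ^ γ ξ + |g ξ| ^ γ ξ) / k := by
        refine integral_mono_ae hint ((hf.2.add hg.2).div_const k) ?_
        filter_upwards [h.le] with ξ hξ
        rw [add_div]
        exact add_le_add (key _ _ (by linarith [h.one_lt])) (key _ _ (by linarith [h.one_lt]))
    _ = I / k := integral_div _ _
    _ ≤ 1 := (div_le_one hk0).2 (le_max_right _ _)

lemma Admissible.of_graph (h : IsExponent T γ p P) (hf : MemLVar T γ f)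
    (hg : MemLVar T γ g) (hk0 : 0 < k)
    (hk : ∫ ξ in square T, (|f ξ / k| ^ γ ξ + |g ξ / k| ^ γ ξ) ≤ 1) :
    Admissible T γ f k ∧ Admissible T γ g k := by
  have h1 := (hf.div_const h k).2
  have h2 := (hg.div_const h k).2
  rw [integral_add h1 h2] at hk
  have h3 : 0 ≤ ∫ ξ in square T, |f ξ / k| ^ γ ξ :=
    integral_nonneg fun ξ => abs_rpow_nonneg _ _
  have h4 : 0 ≤ ∫ ξ in square T, |g ξ / k| ^ γ ξ :=
    integral_nonneg fun ξ => abs_rpow_nonneg _ _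
  exact ⟨⟨hk0, h1, by linarith⟩, hk0, h2, by linarith⟩

lemma exists_admissible (h : IsExponent T γ p P) (hf : MemLVar T γ f) :
    ∃ k, Admissible T γ f k := by
  obtain ⟨k, hk0, -, hk⟩ := exists_graph_admissible h hf hf
  exact ⟨k, (Admissible.of_graph h hf hf hk0 hk).1⟩

lemma exists_admissible_of_graphNorm_lt (h : IsExponent T γ p P) (hf : MemLVar T γ f)
    (hg : MemLVar T γ g) {ε : ℝ} (hε : graphNorm T γ f g < ε) :
    ∃ k < ε, Admissible T γ f k ∧ Admissible T γ g k := by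
  obtain ⟨k, ⟨hk0, -, hk⟩, hlt⟩ := exists_lt_of_csInf_lt (exists_graph_admissible h hf hg) hε
  exact ⟨k, hlt, Admissible.of_graph h hf hg hk0 hk⟩

lemma luxNorm_nonneg (T : ℝ) (γ f : ℝ × ℝ → ℝ) : 0 ≤ luxNorm T γ f :=
  Real.sInf_nonneg fun _ hk => hk.1.le

lemma rpow_le_one_add_rpow {x a b : ℝ} (hx : 0 ≤ x) (ha : 0 ≤ a) (hab : a ≤ b) :
    x ^ a ≤ 1 + x ^ b := by
  rcases le_total x 1 with h | h
  · linarith [Real.rpow_le_one hx h ha, Real.rpow_nonneg hx b]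
  · linarith [Real.rpow_le_rpow_of_exponent_le h hab]

/-- Lower powers of an admissibly normalized function have a controlled integral. -/
lemma Admissible.lintegral_rpow_le (h : IsExponent T γ p P) {q : ℝ} (hq : 0 ≤ q) (hqp : q ≤ p)
    (hk : Admissible T γ g k) :
    ∫⁻ ξ in square T, ENNReal.ofReal (|g ξ / k| ^ q) ≤ volume (square T) + 1 := by
  calc ∫⁻ ξ in square T, ENNReal.ofReal (|g ξ / k| ^ q)
      ≤ ∫⁻ ξ in square T, (1 + ENNReal.ofReal (|g ξ / k| ^ γ ξ)) := by
        refine lintegral_mono_ae ?_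
        filter_upwards [h.le] with ξ hξ
        rw [← ENNReal.ofReal_one, ← ENNReal.ofReal_add zero_le_one (abs_rpow_nonneg _ _)]
        exact ENNReal.ofReal_le_ofReal
          (rpow_le_one_add_rpow (abs_nonneg _) hq (hqp.trans hξ))
    _ = volume (square T) + ENNReal.ofReal (∫ ξ in square T, |g ξ / k| ^ γ ξ) := by
        rw [lintegral_add_left measurable_const, lintegral_one, Measure.restrict_apply_univ,
          ofReal_integral_eq_lintegral_ofReal hk.2.1 (ae_of_all _ fun ξ => abs_rpow_nonneg _ _)]
    _ ≤ volume (square T) + 1 := by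
        gcongr
        exact ENNReal.ofReal_le_one.2 hk.2.2

lemma Admissible.lintegral_enorm_le (h : IsExponent T γ p P) (hk : Admissible T γ g k) :
    ∫⁻ ξ in square T, ‖g ξ‖ₑ ≤ ENNReal.ofReal k * (volume (square T) + 1) := by
  have h1 : ∀ ξ, ‖g ξ‖ₑ = ENNReal.ofReal k * ENNReal.ofReal (|g ξ / k| ^ (1 : ℝ)) := fun ξ => by
    rw [Real.rpow_one, ← ENNReal.ofReal_mul hk.1.le, abs_div, abs_of_pos hk.1,
      mul_div_cancel₀ _ hk.1.ne', Real.enorm_eq_ofReal_abs]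
  simp_rw [h1]
  rw [lintegral_const_mul' _ _ ENNReal.ofReal_ne_top]
  gcongr
  exact hk.lintegral_rpow_le h zero_le_one h.one_lt.le

lemma MemLVar.integrableOn (h : IsExponent T γ p P) (hf : MemLVar T γ f) :
    IntegrableOn f (square T) := by
  obtain ⟨k, hk⟩ := exists_admissible h hf
  exact ⟨hf.1, (hk.lintegral_enorm_le h).trans_lt
    (ENNReal.mul_lt_top ENNReal.ofReal_lt_top
      (ENNReal.add_lt_top.2 ⟨volume_square_lt_top T, ENNReal.one_lt_top⟩))⟩

end

/-! ### The embedding into bounded functions. -/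

lemma lintegral_rlDensity_rpow_lt_top {a q : ℝ} (ha : 0 < a) (hq : 0 < q)
    (haq : -1 < (a - 1) * q) (R : ℝ) :
    ∫⁻ r, ((Iic R).indicator (fun r => ENNReal.ofReal (rlDensity a r)) r) ^ q < ⊤ := by
  have hI : IntegrableOn (fun r : ℝ => r ^ ((a - 1) * q) / Real.Gamma a ^ q) (Ioc 0 R) := by
    rcases le_or_gt R 0 with h | h
    · simp [Ioc_eq_empty (not_lt.2 h)]
    · exact ((intervalIntegrable_iff_integrableOn_Ioc_of_le h.le).1
        (intervalIntegral.intervalIntegrable_rpow' haq)).div_const _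
  refine lt_of_le_of_lt (le_of_eq ?_) hI.2
  rw [← lintegral_indicator measurableSet_Ioc]
  refine lintegral_congr fun r => ?_
  by_cases hr : r ∈ Ioc 0 R
  · have h1 : 0 ≤ r ^ (a - 1) / Real.Gamma a :=
      div_nonneg (Real.rpow_nonneg hr.1.le _) (Real.Gamma_pos_of_pos ha).le
    rw [indicator_of_mem hr, indicator_of_mem (show r ∈ Iic R from hr.2), rlDensity, if_pos hr.1,
      ENNReal.ofReal_rpow_of_nonneg h1 hq.le,
      Real.div_rpow (Real.rpow_nonneg hr.1.le _) (Real.Gamma_pos_of_pos ha).le,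
      ← Real.rpow_mul hr.1.le, Real.enorm_of_nonneg]
    exact div_nonneg (Real.rpow_nonneg hr.1.le _)
      (Real.rpow_nonneg (Real.Gamma_pos_of_pos ha).le _)
  · rw [indicator_of_notMem hr]
    by_cases h2 : r ∈ Iic R
    · have h3 : ¬ 0 < r := fun h => hr ⟨h, h2⟩
      rw [indicator_of_mem h2, rlDensity, if_neg h3, ENNReal.ofReal_zero, ENNReal.zero_rpow_of_pos hq]
    · rw [indicator_of_notMem h2, ENNReal.zero_rpow_of_pos hq]

namespace ChiExt

variable {T : ℝ} {χ : ℝ → ℝ} (E : ChiExt T χ) {γ f g : ℝ × ℝ → ℝ} {p P k : ℝ}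

lemma lift_sub (f g : ℝ × ℝ → ℝ) : E.lift (f - g) = E.lift f - E.lift g := by
  ext t; simp [lift, indicator_sub']

lemma aestronglyMeasurable_lift (hg : AEStronglyMeasurable g (volume.restrict (square T))) :
    AEStronglyMeasurable (E.lift g) volume := by
  rw [← restrict_openSquare, ← aestronglyMeasurable_indicator_iff (measurableSet_openSquare T)]
    at hg
  exact hg.comp_quasiMeasurePreserving E.quasiMeasurePreserving_XX_symm

lemma quasiMeasurePreserving_sub_left (t : ℝ × ℝ) :
    Measure.QuasiMeasurePreserving (fun r => t - r) (volume : Measure (ℝ × ℝ)) volume :=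
  (Measure.measurePreserving_sub_left volume t).quasiMeasurePreserving

/-- The Jacobian χ'(ξ₁)χ'(ξ₂) is at most D², and φ(0) = 0 removes the contribution from outside the
square. -/
lemma lintegral_lift_le {φ : ℝ → ENNReal} (hφ : Measurable φ) (hφ0 : φ 0 = 0)
    (hg : AEStronglyMeasurable g (volume.restrict (square T))) :
    ∫⁻ t, φ (E.lift g t) ≤ ENNReal.ofReal (E.D ^ 2) * ∫⁻ ξ in square T, φ (g ξ) := by
  have hg' := hg
  rw [← restrict_openSquare, ← aestronglyMeasurable_indicator_iff (measurableSet_openSquare T)]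
    at hg'
  have hm : AEMeasurable (fun ξ => φ ((openSquare T).indicator g ξ)) volume :=
    hφ.comp_aemeasurable hg'.aemeasurable
  have hm' : AEMeasurable (fun ξ => φ ((openSquare T).indicator g ξ))
      (Measure.map E.XX.symm volume) :=
    hm.mono_ac E.quasiMeasurePreserving_XX_symm.absolutelyContinuous
  calc ∫⁻ t, φ (E.lift g t)
      = ∫⁻ ξ, φ ((openSquare T).indicator g ξ) ∂(Measure.map E.XX.symm volume) :=
        (lintegral_map' hm' E.XX.symm.continuous.aemeasurable).symm
    _ ≤ ∫⁻ ξ, φ ((openSquare T).indicator g ξ) ∂(ENNReal.ofReal (E.D ^ 2) • volume) :=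
        lintegral_mono' E.map_XX_symm_volume_le le_rfl
    _ = ENNReal.ofReal (E.D ^ 2) * ∫⁻ ξ, φ ((openSquare T).indicator g ξ) := by
        rw [lintegral_smul_measure, smul_eq_mul]
    _ = ENNReal.ofReal (E.D ^ 2) * ∫⁻ ξ in square T, φ (g ξ) := by
        rw [← restrict_openSquare, ← lintegral_indicator (measurableSet_openSquare T)]
        congr 1
        refine lintegral_congr fun ξ => ?_
        by_cases h : ξ ∈ openSquare T <;> simp [h, hφ0]

lemma lift_sub_eq_zero {ξ r : ℝ × ℝ} (hξ : ξ ∈ openSquare T)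
    (hr : E.X T - E.X 0 < r.1 ∨ E.X T - E.X 0 < r.2) : E.lift g (E.XX ξ - r) = 0 := by
  have h1 := E.X.strictMono hξ.1.2
  have h2 := E.X.strictMono hξ.2.2
  refine E.isCausal_lift g _ ?_
  simp only [Prod.fst_sub, Prod.snd_sub, XX_fst, XX_snd]
  rcases hr with h | h
  · left; linarith
  · right; linarith

/-- The Riemann-Liouville integral of order `(α₁, α₂)` maps the variable exponent Lebesgue space
into bounded functions. -/
lemma exists_kernel_bound (h : IsExponent T γ p P) {α₁ α₂ : ℝ} (h₁ : 1 / p < α₁)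
    (h₂ : 1 / p < α₂) :
    ∃ C : ℝ, 0 < C ∧ ∀ g k, AEStronglyMeasurable g (volume.restrict (square T)) →
      Admissible T γ g k → ∀ ξ ∈ openSquare T,
        Integrable (fun r => E.lift g (E.XX ξ - r)) (rlMeasure₂ α₁ α₂) ∧
        |rl α₁ α₂ (E.lift g) (E.XX ξ)| ≤ C * k := by
  have hp1 := h.one_lt
  have hp0 : 0 < p := one_pos.trans hp1
  have hpi : 0 < 1 / p := one_div_pos.2 hp0
  set q := p.conjExponent
  have hpq : p.HolderConjugate q := Real.HolderConjugate.conjExponent hp1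
  have hq0 : 0 < q := hpq.symm.pos
  -- The condition a > 1/p is exactly L^q integrability of r^(a-1) at 0, because q/p = q - 1.
  have hexp : ∀ {a : ℝ}, 1 / p < a → -1 < (a - 1) * q := fun {a} ha => by
    have h3 : 1 / p * q = q - 1 := by
      have := hpq.inv_add_inv_eq_one
      field_simp at this ⊢
      linarith
    nlinarith [mul_lt_mul_of_pos_right ha hq0]
  set R := E.X T - E.X 0
  set κ : ℝ → ℝ → ENNReal := fun a => (Iic R).indicator fun r => ENNReal.ofReal (rlDensity a r)
  have hκ : ∀ a, Measurable (κ a) := fun a =>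
    (measurable_rlDensity a).ennreal_ofReal.indicator measurableSet_Iic
  -- The two terms bound the q-th power of the truncated kernel and the p-th power of the lifted
  -- g/k. As g/k is normalized, Young's inequality suffices in place of Hölder's.
  set K : ENNReal := (∫⁻ r, κ α₁ r ^ q) * (∫⁻ r, κ α₂ r ^ q) +
    ENNReal.ofReal (E.D ^ 2) * (volume (square T) + 1)
  have hα₁ : 0 < α₁ := hpi.trans h₁
  have hα₂ : 0 < α₂ := hpi.trans h₂
  have hK : K < ⊤ := ENNReal.add_lt_top.2
    ⟨ENNReal.mul_lt_top (lintegral_rlDensity_rpow_lt_top hα₁ hq0 (hexp h₁) R)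
      (lintegral_rlDensity_rpow_lt_top hα₂ hq0 (hexp h₂) R),
      ENNReal.mul_lt_top ENNReal.ofReal_lt_top
        (ENNReal.add_lt_top.2 ⟨volume_square_lt_top T, ENNReal.one_lt_top⟩)⟩
  have hbound : ∀ g k, AEStronglyMeasurable g (volume.restrict (square T)) →
      Admissible T γ g k → ∀ ξ ∈ openSquare T,
      ∫⁻ r, ‖E.lift g (E.XX ξ - r)‖ₑ ∂rlMeasure₂ α₁ α₂ ≤ ENNReal.ofReal k * K := by
    intro g k hg hk ξ hξ
    set N : ℝ × ℝ → ENNReal := fun r => ENNReal.ofReal (|E.lift g (E.XX ξ - r) / k|)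
    have hN : ∀ r, ‖E.lift g (E.XX ξ - r)‖ₑ = ENNReal.ofReal k * N r := fun r => by
      rw [← ENNReal.ofReal_mul hk.1.le, abs_div, abs_of_pos hk.1, mul_div_cancel₀ _ hk.1.ne',
        Real.enorm_eq_ofReal_abs]
    have hNm : AEMeasurable N volume :=
      ((((E.aestronglyMeasurable_lift hg).comp_quasiMeasurePreserving
        (quasiMeasurePreserving_sub_left (E.XX ξ))).aemeasurable.div_const k).norm).ennreal_ofReal
    have hm1 := (measurable_rlDensity α₁).ennreal_ofReal
    have hm2 := (measurable_rlDensity α₂).ennreal_ofReal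
    have hm12 : Measurable fun z : ℝ × ℝ =>
        ENNReal.ofReal (rlDensity α₁ z.1) * ENNReal.ofReal (rlDensity α₂ z.2) :=
      (hm1.comp measurable_fst).mul (hm2.comp measurable_snd)
    rw [rlMeasure₂, rlMeasure_of_ne hα₁.ne', rlMeasure_of_ne hα₂.ne', prod_withDensity hm1 hm2,
      ← Measure.volume_eq_prod]
    simp_rw [hN]
    rw [lintegral_const_mul' _ _ ENNReal.ofReal_ne_top,
      lintegral_withDensity_eq_lintegral_mul₀
        hm12.aemeasurable hNm]
    refine mul_le_mul_right ?_ _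
    have hle1 : (1 : ENNReal) ≤ ENNReal.ofReal p := by
      rw [← ENNReal.ofReal_one]; exact ENNReal.ofReal_le_ofReal hp1.le
    have hle2 : (1 : ENNReal) ≤ ENNReal.ofReal q := by
      rw [← ENNReal.ofReal_one]; exact ENNReal.ofReal_le_ofReal hpq.symm.lt.le
    -- Beyond R the lift vanishes by causality, so the kernel may be truncated there. The factors
    -- 1/q and 1/p from Young's inequality are dropped.
    have hpt : ∀ r, ENNReal.ofReal (rlDensity α₁ r.1) * ENNReal.ofReal (rlDensity α₂ r.2) * N r ≤
        κ α₁ r.1 ^ q * κ α₂ r.2 ^ q + N r ^ p := by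
      intro r
      by_cases hr : R < r.1 ∨ R < r.2
      · have : N r = 0 := by simp only [N]; rw [E.lift_sub_eq_zero hξ hr]; simp
        rw [this, mul_zero]
        exact zero_le
      · rw [not_or, not_lt, not_lt] at hr
        have e1 : κ α₁ r.1 = ENNReal.ofReal (rlDensity α₁ r.1) := indicator_of_mem (show r.1 ∈ Iic R from hr.1) _
        have e2 : κ α₂ r.2 = ENNReal.ofReal (rlDensity α₂ r.2) := indicator_of_mem (show r.2 ∈ Iic R from hr.2) _
        rw [← e1, ← e2, ← ENNReal.mul_rpow_of_nonneg _ _ hq0.le]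
        refine (ENNReal.young_inequality _ _ hpq.symm).trans ?_
        gcongr
        · exact ENNReal.div_le_of_le_mul' (le_mul_of_one_le_left zero_le hle2)
        · exact ENNReal.div_le_of_le_mul' (le_mul_of_one_le_left zero_le hle1)
    refine (lintegral_mono hpt).trans ?_
    rw [lintegral_add_left (f := fun r : ℝ × ℝ => κ α₁ r.1 ^ q * κ α₂ r.2 ^ q) (((hκ α₁).comp measurable_fst).pow_const q |>.mul
      (((hκ α₂).comp measurable_snd).pow_const q)), Measure.volume_eq_prod,
      lintegral_prod_mul (f := fun r => κ α₁ r ^ q) (g := fun r => κ α₂ r ^ q) ((hκ α₁).pow_const q).aemeasurable ((hκ α₂).pow_const q).aemeasurable,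
      ← Measure.volume_eq_prod]
    refine add_le_add le_rfl ?_
    have hNp : ∀ r, N r ^ p = ENNReal.ofReal (|E.lift g (E.XX ξ - r) / k| ^ p) := fun r =>
      ENNReal.ofReal_rpow_of_nonneg (abs_nonneg _) hp0.le
    simp_rw [hNp]
    rw [lintegral_sub_left_eq_self (fun t => ENNReal.ofReal (|E.lift g t / k| ^ p)) (E.XX ξ)]
    refine (E.lintegral_lift_le (φ := fun x => ENNReal.ofReal (|x / k| ^ p)) (by fun_prop)
      (by simp [hp0.ne']) hg).trans ?_
    gcongr
    exact hk.lintegral_rpow_le h hp0.le le_rfl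
  refine ⟨K.toReal + 1, by positivity, fun g k hg hk ξ hξ => ?_⟩
  have hb := hbound g k hg hk ξ hξ
  have hkK : ENNReal.ofReal k * K < ⊤ := ENNReal.mul_lt_top ENNReal.ofReal_lt_top hK
  refine ⟨⟨?_, hb.trans_lt hkK⟩, ?_⟩
  · exact ((E.aestronglyMeasurable_lift hg).comp_quasiMeasurePreserving
      (quasiMeasurePreserving_sub_left _)).mono_ac
      (rlMeasure₂_absolutelyContinuous hα₁.ne' hα₂.ne')
  · have h1 : ‖rl α₁ α₂ (E.lift g) (E.XX ξ)‖ₑ ≤ ENNReal.ofReal k * K :=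
      (enorm_integral_le_lintegral_enorm _).trans hb
    have h2 := ENNReal.toReal_mono hkK.ne h1
    rw [toReal_enorm, ENNReal.toReal_mul, ENNReal.toReal_ofReal hk.1.le, Real.norm_eq_abs] at h2
    nlinarith [hk.1]

variable {α₁ α₂ β : ℝ}

/-- Elements of the fractional derivative space are Riemann-Liouville integrals of their
derivative. -/
lemma ae_eq_rl (h : IsExponent T γ p P) (h₁ : 1 / p < α₁) (h₂ : 1 / p < α₂)
    (hα₁ : α₁ < 1) (hα₂ : α₂ < 1) (hβ0 : 0 ≤ β) (hβ1 : β ≤ 1) {φ : ℝ × ℝ → ℝ}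
    (hφ : HasHilferDeriv T χ α₁ α₂ β γ φ g) :
    ∀ᵐ ξ ∂volume.restrict (square T), φ ξ = rl α₁ α₂ (E.lift g) (E.XX ξ) := by
  obtain ⟨hφm, hgm, u, hu, hlim⟩ := hφ
  obtain ⟨C, hC0, hC⟩ := E.exists_kernel_bound h h₁ h₂
  have hpi : 0 < 1 / p := one_div_pos.2 (one_pos.trans h.one_lt)
  have hum : ∀ n, MemLVar T γ (u n) := fun n => (hu n).1.memLVar h
  -- The summand 1/(n+1) leaves room strictly above the infimum, so that an admissible k below e(n)
  -- exists.
  set e : ℕ → ℝ := fun n =>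
    graphNorm T γ (φ - u n) (g - hilfer T χ α₁ α₂ β (u n)) + 1 / ((n : ℝ) + 1)
  have he : Tendsto e atTop (𝓝 0) := by
    simpa [e] using hlim.add tendsto_one_div_add_atTop_nhds_zero_nat
  have hex : ∀ n, ∃ k < e n, Admissible T γ (φ - u n) k ∧
      Admissible T γ (g - hilfer T χ α₁ α₂ β (u n)) k := fun n =>
    exists_admissible_of_graphNorm_lt h (hφm.sub h (hum n)) (hgm.sub h (hu n).2)
      (lt_add_of_pos_right _ (by positivity))
  choose k hke hk1 hk2 using hex
  have hk0 : Tendsto k atTop (𝓝 0) :=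
    squeeze_zero (fun n => (hk1 n).1.le) (fun n => (hke n).le) he
  have hunif : ∀ ξ ∈ openSquare T,
      Tendsto (fun n => u n ξ) atTop (𝓝 (rl α₁ α₂ (E.lift g) (E.XX ξ))) := by
    intro ξ hξ
    have hb : ∀ n, |rl α₁ α₂ (E.lift g) (E.XX ξ) - u n ξ| ≤ C * k n := fun n => by
      obtain ⟨k₁, hk₁⟩ := exists_admissible h hgm
      obtain ⟨k₂, hk₂⟩ := exists_admissible h (hu n).2
      have i1 := (hC _ _ hgm.1 hk₁ ξ hξ).1
      have i2 := (hC _ _ (hu n).2.1 hk₂ ξ hξ).1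
      have := (hC _ _ (hgm.1.sub (hu n).2.1) (hk2 n) ξ hξ).2
      rw [lift_sub] at this
      rw [← E.rl_lift_hilfer (hpi.trans h₁).le (hpi.trans h₂).le hα₁ hα₂ hβ0 hβ1 (hu n).1 hξ]
      refine le_of_eq_of_le ?_ this
      congr 1
      exact (integral_sub i1 i2).symm
    rw [tendsto_iff_dist_tendsto_zero]
    refine squeeze_zero (fun _ => dist_nonneg) (fun n => ?_) (by simpa using hk0.const_mul C)
    rw [dist_comm, Real.dist_eq]
    exact hb n
  -- The approximants converge pointwise to the fractional integral of g. Convergence to φ in L¹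
  -- yields an almost everywhere convergent subsequence, which identifies the two limits.
  have hL1 : Tendsto (fun n => eLpNorm (u n - φ) 1 (volume.restrict (square T))) atTop (𝓝 0) := by
    have hfin : volume (square T) + 1 ≠ ⊤ :=
      (ENNReal.add_lt_top.2 ⟨volume_square_lt_top T, ENNReal.one_lt_top⟩).ne
    have hz : Tendsto (fun n => ENNReal.ofReal (k n) * (volume (square T) + 1)) atTop (𝓝 0) := by
      have := ENNReal.Tendsto.mul_const (ENNReal.tendsto_ofReal hk0) (Or.inr hfin)
      simpa using this
    refine tendsto_of_tendsto_of_tendsto_of_le_of_le tendsto_const_nhds hz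
      (fun _ => zero_le) fun n => ?_
    simp only
    rw [eLpNorm_sub_comm, eLpNorm_one_eq_lintegral_enorm]
    exact (hk1 n).lintegral_enorm_le h
  obtain ⟨ns, hns, hsub⟩ := (tendstoInMeasure_of_tendsto_eLpNorm one_ne_zero
    (fun n => (hum n).1) hφm.1 hL1).exists_seq_tendsto_ae
  have hQ : ∀ᵐ ξ ∂volume.restrict (square T), ξ ∈ openSquare T := by
    rw [← restrict_openSquare]
    exact ae_restrict_mem (measurableSet_openSquare T)
  filter_upwards [hsub, hQ] with ξ h1 h2
  exact tendsto_nhds_unique h1 ((hunif ξ h2).comp hns.tendsto_atTop)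

/-- The kernel bound holds for every admissible k, hence for their infimum. The constant does not
depend on φ. -/
lemma exists_abs_le_luxNorm (E : ChiExt T χ) (h : IsExponent T γ p P) (h₁ : 1 / p < α₁) (h₂ : 1 / p < α₂)
    (hα₁ : α₁ < 1) (hα₂ : α₂ < 1) (hβ0 : 0 ≤ β) (hβ1 : β ≤ 1) :
    ∃ C : ℝ, 0 < C ∧ ∀ φ g, HasHilferDeriv T χ α₁ α₂ β γ φ g →
      ∀ᵐ ξ ∂volume.restrict (square T), |φ ξ| ≤ C * luxNorm T γ g := by
  obtain ⟨C, hC0, hC⟩ := E.exists_kernel_bound h h₁ h₂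
  refine ⟨C, hC0, fun φ g hφ => ?_⟩
  have hQ : ∀ᵐ ξ ∂volume.restrict (square T), ξ ∈ openSquare T := by
    rw [← restrict_openSquare]
    exact ae_restrict_mem (measurableSet_openSquare T)
  filter_upwards [E.ae_eq_rl h h₁ h₂ hα₁ hα₂ hβ0 hβ1 hφ, hQ] with ξ h1 h2
  rw [h1, ← div_le_iff₀' hC0]
  refine le_csInf (exists_admissible h hφ.2.1) fun k hk => ?_
  rw [div_le_iff₀' hC0]
  exact (hC g k hφ.2.1.1 hk ξ h2).2

end ChiExt

/-! ### Injectivity of the fractional integral and uniqueness of the derivative. -/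

/-- An integrable function on the plane whose integrals over all quadrants vanish is null. -/
lemma ae_eq_zero_of_setIntegral_Iio {h : ℝ × ℝ → ℝ} (hi : Integrable h)
    (h0 : ∀ a b, ∫ t in Iio a ×ˢ Iio b, h t = 0) : h =ᵐ[volume] 0 := by
  have hspan : IsCountablySpanning (range (Iio : ℝ → Set ℝ)) :=
    ⟨fun n : ℕ => Iio (n : ℝ), fun n => mem_range_self _, by
      ext x
      simpa using exists_nat_gt x⟩
  have hgen : MeasurableSpace.generateFrom (range (Iio : ℝ → Set ℝ)) =
      (inferInstance : MeasurableSpace ℝ) := by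
    rw [← borel_eq_generateFrom_Iio, ← BorelSpace.measurable_eq]
  have huniv : ∫ t, h t = 0 := by
    have hmono : Monotone fun n : ℕ => Iio (n : ℝ) ×ˢ Iio (n : ℝ) := fun n m hnm =>
      prod_mono (Iio_subset_Iio (by exact_mod_cast hnm)) (Iio_subset_Iio (by exact_mod_cast hnm))
    have ht := tendsto_setIntegral_of_monotone (μ := volume) (f := h)
      (fun n : ℕ => (measurableSet_Iio (a := (n : ℝ))).prod (measurableSet_Iio (a := (n : ℝ))))
      hmono hi.integrableOn
    have hU : (⋃ n : ℕ, Iio (n : ℝ) ×ˢ Iio (n : ℝ)) = univ := by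
      ext x
      obtain ⟨n, hn⟩ := exists_nat_gt (max x.1 x.2)
      simp only [mem_iUnion, mem_univ, iff_true]
      exact ⟨n, (le_max_left _ _).trans_lt hn, (le_max_right _ _).trans_lt hn⟩
    rw [hU, Measure.restrict_univ] at ht
    simp_rw [h0] at ht
    exact (tendsto_nhds_unique ht tendsto_const_nhds)
  refine hi.ae_eq_zero_of_forall_setIntegral_eq_zero fun s hs hfin => ?_
  clear hfin
  induction s, hs using MeasurableSpace.induction_on_inter
    (generateFrom_eq_prod hgen hgen hspan hspan).symm (isPiSystem_Iio.prod isPiSystem_Iio) with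
  | empty => simp
  | basic s hs =>
    obtain ⟨_, ⟨a, rfl⟩, _, ⟨b, rfl⟩, rfl⟩ := hs
    exact h0 a b
  | compl s hs ih =>
    have := integral_add_compl hs hi
    rw [ih, huniv] at this
    linarith
  | iUnion s hd hs ih =>
    rw [integral_iUnion hs hd hi.integrableOn]
    simp [ih]

lemma rlMeasure_one : rlMeasure 1 = volume.restrict (Ioi 0) := by
  rw [rlMeasure_of_ne one_ne_zero, ← withDensity_indicator_one measurableSet_Ioi]
  congr 1
  ext r
  by_cases hr : 0 < r <;> simp [rlDensity, hr]

lemma rlMeasure₂_one : rlMeasure₂ 1 1 = volume.restrict (Ioi 0 ×ˢ Ioi 0) := by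
  rw [rlMeasure₂, rlMeasure_one, Measure.prod_restrict]
  rfl

lemma rl_one_one_eq_setIntegral (G : ℝ × ℝ → ℝ) (t : ℝ × ℝ) :
    rl 1 1 G t = ∫ x in Iio t.1 ×ˢ Iio t.2, G x := by
  rw [rl, rlMeasure₂_one, ← integral_indicator (measurableSet_Ioi.prod measurableSet_Ioi),
    ← integral_indicator (measurableSet_Iio.prod measurableSet_Iio),
    ← integral_sub_left_eq_self ((Iio t.1 ×ˢ Iio t.2).indicator G) volume t]
  congr 1
  ext r
  by_cases hr : 0 < r.1 ∧ 0 < r.2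
  · rw [indicator_of_mem (show r ∈ Ioi 0 ×ˢ Ioi 0 from hr),
      indicator_of_mem (show t - r ∈ Iio t.1 ×ˢ Iio t.2 from
        ⟨by simpa using hr.1, by simpa using hr.2⟩)]
  · rw [indicator_of_notMem (show r ∉ Ioi 0 ×ˢ Ioi 0 from hr), indicator_of_notMem]
    exact fun h => hr ⟨by simpa using h.1, by simpa using h.2⟩

namespace ChiExt

variable {T : ℝ} {χ : ℝ → ℝ} (E : ChiExt T χ) {γ f g : ℝ × ℝ → ℝ} {p P k : ℝ}
  {α₁ α₂ β : ℝ}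

lemma integrable_lift (hg : IntegrableOn g (square T)) : Integrable (E.lift g) := by
  refine ⟨E.aestronglyMeasurable_lift hg.1, ?_⟩
  refine (E.lintegral_lift_le (φ := fun x => ‖x‖ₑ) (by fun_prop) (by simp) hg.1).trans_lt ?_
  exact ENNReal.mul_lt_top ENNReal.ofReal_lt_top hg.2

/-- The Riemann-Liouville integral is injective. -/
lemma ae_eq_zero_of_rl_eq_zero (hT : 0 < T) (h₁ : 0 < α₁) (h₂ : 0 < α₂) (hα₁ : α₁ < 1)
    (hα₂ : α₂ < 1) (hg : IntegrableOn g (square T))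
    (h0 : ∀ᵐ ξ ∂volume.restrict (square T), rl α₁ α₂ (E.lift g) (E.XX ξ) = 0) :
    g =ᵐ[volume.restrict (square T)] 0 := by
  have hG := E.integrable_lift hg
  have hGt : ∀ t, Integrable (fun r => E.lift g (t - r)) := fun t => hG.comp_sub_left t
  have hbox : ∀ ξ ∈ openSquare T,
      ∫ x in Iio (E.X ξ.1) ×ˢ Iio (E.X ξ.2), E.lift g x = 0 := by
    intro ξ hξ
    -- Applying I^{1-α} to I^α g = 0 leaves the integral of the lift over a quadrant. The vanishing
    -- holds only almost everywhere, which is enough as the measure of order 1 - α > 0 is absolutely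
    -- continuous.
    have hs : rl (1 - α₁) (1 - α₂) (rl α₁ α₂ (E.lift g)) (E.XX ξ) = rl 1 1 (E.lift g) (E.XX ξ) := by
      have e1 : 1 - α₁ + α₁ = 1 := by ring
      have e2 : 1 - α₂ + α₂ = 1 := by ring
      rw [rl_rl (by linarith) (by linarith) h₁.le h₂.le, e1, e2]
      rw [e1, e2, rlMeasure₂_one]
      exact (hGt _).restrict
    have h := rl_one_one_eq_setIntegral (E.lift g) (E.XX ξ)
    rw [← hs] at h
    simp only [XX_fst, XX_snd] at h
    rw [← h]
    refine integral_eq_zero_of_ae ?_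
    have a1 : ∀ᵐ z, z ∈ square T → rl α₁ α₂ (E.lift g) (E.XX z) = 0 :=
      (ae_restrict_iff' (measurableSet_square T)).1 h0
    have a2 := (quasiMeasurePreserving_sub_left (E.XX ξ)).ae
      (E.quasiMeasurePreserving_XX_symm.ae a1)
    have a3 := (rlMeasure₂_absolutelyContinuous (sub_pos.2 hα₁).ne'
      (sub_pos.2 hα₂).ne').ae_le a2
    filter_upwards [a3, ae_rlMeasure₂_nonneg _ _] with r hr hr0
    by_cases hc : (E.XX ξ - r).1 ≤ E.X 0 ∨ (E.XX ξ - r).2 ≤ E.X 0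
    · exact (E.isCausal_lift g).rl _ hc
    · rw [not_or, not_le, not_le] at hc
      rw [E.XX.apply_symm_apply] at hr
      refine hr ⟨⟨(E.X.lt_symm_apply.2 hc.1).le, ?_⟩, (E.X.lt_symm_apply.2 hc.2).le, ?_⟩
      · refine (E.X.symm_apply_le.2 ?_).trans hξ.1.2.le
        simpa using hr0.1
      · refine (E.X.symm_apply_le.2 ?_).trans hξ.2.2.le
        simpa using hr0.2
  have hzero : ∀ ξ ∈ openSquare T,
      ∀ᵐ t, t ∈ Iio (E.X ξ.1) ×ˢ Iio (E.X ξ.2) → E.lift g t = 0 := by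
    intro ξ hξ
    have hm : MeasurableSet (Iio (E.X ξ.1) ×ˢ Iio (E.X ξ.2)) :=
      measurableSet_Iio.prod measurableSet_Iio
    have := ae_eq_zero_of_setIntegral_Iio
      (h := (Iio (E.X ξ.1) ×ˢ Iio (E.X ξ.2)).indicator (E.lift g)) (hG.indicator hm) ?_
    · filter_upwards [this] with t ht hmem
      rwa [indicator_of_mem hmem] at ht
    -- An arbitrary quadrant meets the box in a smaller quadrant: its corner is either in the region
    -- where the lift vanishes, or the image of a point of the open square.
    intro a b
    rw [setIntegral_indicator hm, prod_inter_prod, Iio_inter_Iio, Iio_inter_Iio]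
    by_cases hc : min a (E.X ξ.1) ≤ E.X 0 ∨ min b (E.X ξ.2) ≤ E.X 0
    · refine setIntegral_eq_zero_of_forall_eq_zero fun t ht => E.isCausal_lift g t ?_
      exact hc.imp (fun h => (le_of_lt ht.1).trans h) (fun h => (le_of_lt ht.2).trans h)
    · rw [not_or, not_le, not_le] at hc
      have := hbox (E.X.symm (min a (E.X ξ.1)), E.X.symm (min b (E.X ξ.2)))
        ⟨⟨E.X.lt_symm_apply.2 hc.1, (E.X.symm_apply_le.2 (min_le_right _ _)).trans_lt hξ.1.2⟩,
          E.X.lt_symm_apply.2 hc.2, (E.X.symm_apply_le.2 (min_le_right _ _)).trans_lt hξ.2.2⟩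
      simpa using this
  -- Countably many corners exhaust the open square; the offset 2 keeps the corner for n = 0 away
  -- from the origin.
  have hn : ∀ n : ℕ, T - T / ((n : ℝ) + 2) ∈ Ioo 0 T := fun n => by
    have h2 : (0 : ℝ) < (n : ℝ) + 2 := by positivity
    have h3 : T / ((n : ℝ) + 2) < T := div_lt_self hT (by linarith [n.cast_nonneg (α := ℝ)])
    exact ⟨by linarith, by linarith [div_pos hT h2]⟩
  have hall := E.quasiMeasurePreserving_XX.ae (ae_all_iff.2 fun n : ℕ =>
    hzero (T - T / ((n : ℝ) + 2), T - T / ((n : ℝ) + 2)) ⟨hn n, hn n⟩)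
  rw [← restrict_openSquare]
  filter_upwards [ae_restrict_of_ae hall, ae_restrict_mem (measurableSet_openSquare T)]
    with z hz hzQ
  have hpos : 0 < T - max z.1 z.2 := sub_pos.2 (max_lt hzQ.1.2 hzQ.2.2)
  obtain ⟨n, hn'⟩ := exists_nat_gt (T / (T - max z.1 z.2))
  have hlt : max z.1 z.2 < T - T / ((n : ℝ) + 2) := by
    have h2 : (0 : ℝ) < (n : ℝ) + 2 := by positivity
    have : T / ((n : ℝ) + 2) < T - max z.1 z.2 := by
      rw [div_lt_iff₀ h2]
      rw [div_lt_iff₀ hpos] at hn'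
      nlinarith
    linarith
  have := hz n ⟨E.X.strictMono ((le_max_left _ _).trans_lt hlt),
    E.X.strictMono ((le_max_right _ _).trans_lt hlt)⟩
  rwa [E.lift_XX_of_mem hzQ] at this

lemma hasHilferDeriv_unique (E : ChiExt T χ) (hT : 0 < T) (h : IsExponent T γ p P)
    (h₁ : 1 / p < α₁) (h₂ : 1 / p < α₂)
    (hα₁ : α₁ < 1) (hα₂ : α₂ < 1) (hβ0 : 0 ≤ β) (hβ1 : β ≤ 1) {φ : ℝ × ℝ → ℝ}
    (hf : HasHilferDeriv T χ α₁ α₂ β γ φ f) (hg : HasHilferDeriv T χ α₁ α₂ β γ φ g) :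
    f =ᵐ[volume.restrict (square T)] g := by
  have hpi : 0 < 1 / p := one_div_pos.2 (one_pos.trans h.one_lt)
  obtain ⟨C, hC0, hC⟩ := E.exists_kernel_bound h h₁ h₂
  obtain ⟨k₁, hk₁⟩ := exists_admissible h hf.2.1
  obtain ⟨k₂, hk₂⟩ := exists_admissible h hg.2.1
  have hQ : ∀ᵐ ξ ∂volume.restrict (square T), ξ ∈ openSquare T := by
    rw [← restrict_openSquare]
    exact ae_restrict_mem (measurableSet_openSquare T)
  refine sub_ae_eq_zero _ _ |>.1 (E.ae_eq_zero_of_rl_eq_zero hT (hpi.trans h₁) (hpi.trans h₂)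
    hα₁ hα₂ ((hf.2.1.sub h hg.2.1).integrableOn h) ?_)
  filter_upwards [E.ae_eq_rl h h₁ h₂ hα₁ hα₂ hβ0 hβ1 hf, E.ae_eq_rl h h₁ h₂ hα₁ hα₂ hβ0 hβ1 hg,
    hQ] with ξ e1 e2 hξ
  have i1 := (hC _ _ hf.2.1.1 hk₁ ξ hξ).1
  have i2 := (hC _ _ hg.2.1.1 hk₂ ξ hξ).1
  have := integral_sub i1 i2
  rw [lift_sub]
  refine this.trans ?_
  exact sub_eq_zero.2 (e1.symm.trans e2)

end ChiExt

/-! ### Homogeneity of the Hilfer derivative. -/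

section Scaling

variable {T : ℝ} {χ : ℝ → ℝ} {γ : ℝ × ℝ → ℝ} {p P α₁ α₂ β : ℝ}

lemma fracInt₁_const_mul (T : ℝ) (χ : ℝ → ℝ) (μ c : ℝ) (f : ℝ → ℝ) (x : ℝ) :
    fracInt₁ T χ μ (fun s => c * f s) x = c * fracInt₁ T χ μ f x := by
  unfold fracInt₁
  split_ifs
  · rfl
  · rw [mul_left_comm c, ← intervalIntegral.integral_const_mul c]
    congr 1
    exact intervalIntegral.integral_congr fun s _ => by ring

lemma hilfer_const_mul (T : ℝ) (χ : ℝ → ℝ) (α₁ α₂ β c : ℝ) (f ξ) :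
    hilfer T χ α₁ α₂ β (fun z => c * f z) ξ = c * hilfer T χ α₁ α₂ β f ξ := by
  have h1 : ∀ a b (f : ℝ × ℝ → ℝ), fracInt T χ a b (fun z => c * f z) =
      fun ξ => c * fracInt T χ a b f ξ := fun a b f => by
    ext ξ
    simp only [fracInt, fracInt₁_const_mul]
  have h2 : ∀ f : ℝ × ℝ → ℝ, mixedDeriv T χ (fun z => c * f z) =
      fun ξ => c * mixedDeriv T χ f ξ := fun f => by
    ext ξ
    simp only [mixedDeriv, deriv_const_mul_field]
    ring
  rw [hilfer, h1, h2, h1]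
  rfl

lemma graphNorm_const_mul {c : ℝ} (hc : 0 < c) (f g : ℝ × ℝ → ℝ) :
    graphNorm T γ (fun ξ => c * f ξ) (fun ξ => c * g ξ) = c * graphNorm T γ f g := by
  unfold graphNorm
  rw [← smul_eq_mul, ← Real.sInf_smul_of_nonneg hc.le]
  congr 1
  ext k
  have hk : ∀ x, c * x / k = x / (c⁻¹ * k) := fun x => by field_simp
  simp only [mem_ofPred_eq, mem_smul_set_iff_inv_smul_mem₀ hc.ne', smul_eq_mul, hk,
    mul_pos_iff_of_pos_left (inv_pos.2 hc)]

lemma HasHilferDeriv.const_mul (h : IsExponent T γ p P) {c : ℝ} (hc : 0 < c) {φ g : ℝ × ℝ → ℝ}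
    (hφ : HasHilferDeriv T χ α₁ α₂ β γ φ g) :
    HasHilferDeriv T χ α₁ α₂ β γ (fun ξ => c * φ ξ) (fun ξ => c * g ξ) := by
  obtain ⟨hm, hgm, u, hu, hlim⟩ := hφ
  have hD : ∀ n, hilfer T χ α₁ α₂ β (fun ξ => c * u n ξ) =
      fun ξ => c * hilfer T χ α₁ α₂ β (u n) ξ := fun n => by
    ext ξ
    exact hilfer_const_mul _ _ _ _ _ _ _ _
  refine ⟨hm.const_mul h c, hgm.const_mul h c, fun n ξ => c * u n ξ, fun n => ⟨⟨?_, ?_, ?_⟩, ?_⟩, ?_⟩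
  · exact contDiff_const.mul (hu n).1.1
  · exact (hu n).1.2.1.mul_left
  · exact (closure_mono (Function.support_const_smul_subset c (u n))).trans (hu n).1.2.2
  · rw [hD]
    exact (hu n).2.const_mul h c
  · have : ∀ n, graphNorm T γ ((fun ξ => c * φ ξ) - fun ξ => c * u n ξ)
        ((fun ξ => c * g ξ) - hilfer T χ α₁ α₂ β fun ξ => c * u n ξ) =
        c * graphNorm T γ (φ - u n) (g - hilfer T χ α₁ α₂ β (u n)) := fun n => by
      rw [hD, ← graphNorm_const_mul hc]
      congr 1 <;> ext ξ <;> simp only [Pi.sub_apply, mul_sub]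
    simp_rw [this]
    simpa using hlim.const_mul c

lemma hasHilferDeriv_hilferDeriv {φ : ℝ × ℝ → ℝ} (hφ : φ ∈ space T χ α₁ α₂ β γ) :
    HasHilferDeriv T χ α₁ α₂ β γ φ (hilferDeriv T χ α₁ α₂ β γ φ) := by
  have h : ∃ g, HasHilferDeriv T χ α₁ α₂ β γ φ g := hφ
  rw [hilferDeriv, dif_pos h]
  exact h.choose_spec

/-- The chosen derivatives of φ and cφ are unrelated choices; only uniqueness ties them together,
hence the equality almost everywhere. -/
lemma ChiExt.hilferDeriv_const_mul (E : ChiExt T χ) (hT : 0 < T) (h : IsExponent T γ p P)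
    (h₁ : 1 / p < α₁) (h₂ : 1 / p < α₂)
    (hα₁ : α₁ < 1) (hα₂ : α₂ < 1) (hβ0 : 0 ≤ β) (hβ1 : β ≤ 1) {φ : ℝ × ℝ → ℝ}
    (hφ : φ ∈ space T χ α₁ α₂ β γ) {c : ℝ} (hc : 0 < c) :
    hilferDeriv T χ α₁ α₂ β γ (fun ξ => c * φ ξ) =ᵐ[volume.restrict (square T)]
      fun ξ => c * hilferDeriv T χ α₁ α₂ β γ φ ξ := by
  have h1 := (hasHilferDeriv_hilferDeriv hφ).const_mul h hc
  exact E.hasHilferDeriv_unique hT h h₁ h₂ hα₁ hα₂ hβ0 hβ1 (hasHilferDeriv_hilferDeriv ⟨_, h1⟩) h1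

end Scaling

/-! ### Exponent bounds and differentiation of modulars. -/

section

variable {T : ℝ} {γ q m : ℝ × ℝ → ℝ} {p P : ℝ}

lemma square_subset_closure_interior (hT : 0 < T) : square T ⊆ closure (interior (square T)) := by
  rw [square, interior_prod_eq, interior_Icc, closure_prod_eq, closure_Ioo hT.ne]

lemma exists_abs_le_of_continuousOn_square (hγ : ContinuousOn γ (square T)) :
    ∃ C, ∀ ξ ∈ square T, |γ ξ| ≤ C :=
  (isCompact_Icc.prod isCompact_Icc : IsCompact (square T)).exists_bound_of_continuousOn hγ

lemma isExponent_of_continuousOn (hγ : ContinuousOn γ (square T)) (h1 : 1 < expInf T γ) :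
    IsExponent T γ (expInf T γ) (expSup T γ) := by
  obtain ⟨C, hC⟩ := exists_abs_le_of_continuousOn_square hγ
  have hae : ∀ᵐ ξ ∂volume.restrict (square T), |γ ξ| ≤ C :=
    (ae_restrict_mem (measurableSet_square T)).mono hC
  refine ⟨hγ.aemeasurable (measurableSet_square T), h1, ae_essInf_le ?_, ae_le_essSup ?_⟩
  · exact ⟨-C, eventually_map.2 (hae.mono fun ξ h => (abs_le.1 h).1)⟩
  · exact ⟨C, eventually_map.2 (hae.mono fun ξ h => (abs_le.1 h).2)⟩

lemma volume_restrict_square_ne_zero (hT : 0 < T) :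
    (volume : Measure (ℝ × ℝ)).restrict (square T) ≠ 0 := by
  intro h
  have h2 : volume (square T) = 0 := Measure.restrict_eq_zero.1 h
  rw [square, Measure.volume_eq_prod, Measure.prod_prod, Real.volume_Icc] at h2
  simp at h2
  linarith

/-- Attainment turns the pointwise hypothesis 1/γ(ξ) < α_j into the strict inequality 1/γ⁻ < α_j
needed by the kernel bound. -/
lemma exists_eq_expInf (hT : 0 < T) (hγ : ContinuousOn γ (square T)) (h1 : 1 < expInf T γ) :
    ∃ ξ ∈ square T, γ ξ = expInf T γ := by
  have hne : (square T).Nonempty := ⟨(0, 0), ⟨le_rfl, hT.le⟩, le_rfl, hT.le⟩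
  obtain ⟨C, hC⟩ := exists_abs_le_of_continuousOn_square hγ
  obtain ⟨ξ, hξ, hmin⟩ := (isCompact_Icc.prod isCompact_Icc :
    IsCompact (square T)).exists_isMinOn hne hγ
  refine ⟨ξ, hξ, le_antisymm ?_ ?_⟩
  · have : NeBot (ae ((volume : Measure (ℝ × ℝ)).restrict (square T))) :=
      ae_neBot.2 (volume_restrict_square_ne_zero hT)
    have hae := ae_restrict_mem (μ := (volume : Measure (ℝ × ℝ))) (measurableSet_square T)
    refine le_liminf_of_le ?_ (hae.mono fun z hz => hmin hz)
    exact IsBoundedUnder.isCoboundedUnder_ge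
      ⟨C, eventually_map.2 (hae.mono fun ξ h => (abs_le.1 (hC ξ h)).2)⟩
  · have hmineq : (fun z => min (γ z) (expInf T γ)) =ᵐ[volume.restrict (square T)]
        fun _ => expInf T γ :=
      (isExponent_of_continuousOn hγ h1).le.mono fun z hz => min_eq_right hz
    have := Measure.eqOn_of_ae_eq hmineq (hγ.inf continuousOn_const) continuousOn_const
      (square_subset_closure_interior hT) hξ
    exact min_eq_right_iff.1 this

/-- Differentiation under the integral sign: the weight 1/q cancels the exponent, and for |t| < 1
the derivative is dominated by 2^P |m|. -/
lemma hasDerivAt_modular (h : IsExponent T q p P) (hm : IntegrableOn m (square T)) :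
    HasDerivAt (fun t : ℝ => ∫ ξ in square T, 1 / q ξ * ((1 + t) ^ q ξ * m ξ))
      (∫ ξ in square T, m ξ) 0 := by
  have hmeas : ∀ t : ℝ, AEStronglyMeasurable
      (fun ξ => 1 / q ξ * ((1 + t) ^ q ξ * m ξ)) (volume.restrict (square T)) := fun t =>
    ((h.aemeasurable.const_div 1).mul
      ((aemeasurable_const.pow h.aemeasurable).mul hm.aemeasurable)).aestronglyMeasurable
  have hd := hasDerivAt_integral_of_dominated_loc_of_deriv_le (μ := volume.restrict (square T))
    (F := fun (t : ℝ) ξ => 1 / q ξ * ((1 + t) ^ q ξ * m ξ))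
    (F' := fun t ξ => (1 + t) ^ (q ξ - 1) * m ξ) (x₀ := (0 : ℝ)) (s := Ioo (-1) 1)
    (bound := fun ξ => 2 ^ P * |m ξ|) (Ioo_mem_nhds (by norm_num) (by norm_num))
    (Eventually.of_forall hmeas) ?_ ?_ ?_ (hm.norm.const_mul _) ?_
  · simpa using hd.2
  · refine Integrable.mono' hm.norm (hmeas 0) ?_
    filter_upwards [h.le] with ξ hξ
    have h1 : 1 ≤ q ξ := by linarith [h.one_lt]
    rw [add_zero, Real.one_rpow, one_mul, norm_mul, Real.norm_of_nonneg (by positivity)]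
    refine mul_le_of_le_one_left (norm_nonneg _) ?_
    rw [div_le_one (by linarith)]
    exact h1
  · exact ((aemeasurable_const.pow (h.aemeasurable.sub_const 1)).mul
      hm.aemeasurable).aestronglyMeasurable
  · filter_upwards [h.le, h.ge] with ξ h1 h2 t ht
    have ht0 : 0 ≤ 1 + t := by linarith [ht.1]
    rw [norm_mul, Real.norm_of_nonneg (Real.rpow_nonneg ht0 _), Real.norm_eq_abs]
    refine mul_le_mul_of_nonneg_right ?_ (abs_nonneg _)
    exact (Real.rpow_le_rpow ht0 (by linarith [ht.2]) (by linarith [h.one_lt])).trans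
      (Real.rpow_le_rpow_of_exponent_le one_le_two (by linarith))
  · filter_upwards [h.le] with ξ h1 t ht
    have hq : q ξ ≠ 0 := by linarith [h.one_lt]
    have h2 : HasDerivAt (fun t : ℝ => (1 + t) ^ q ξ) (1 * q ξ * (1 + t) ^ (q ξ - 1)) t :=
      ((hasDerivAt_id t).const_add 1).rpow_const (Or.inl (by simp only [id]; linarith [ht.1]))
    refine ((h2.mul_const (m ξ)).const_mul (1 / q ξ)).congr_deriv ?_
    field_simp

/-! ### The Nehari identity and the energy estimate. -/

section Nehari

variable {χ : ℝ → ℝ} {w s η A φ : ℝ × ℝ → ℝ} {α₁ α₂ β lam p' P' p'' P'' : ℝ}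

lemma integrableOn_weight {C : ℝ} (hw : IsExponent T w p P) (hη : ContinuousOn η (square T))
    (hφm : AEStronglyMeasurable φ (volume.restrict (square T)))
    (hφ : ∀ᵐ ξ ∂volume.restrict (square T), |φ ξ| ≤ C) :
    IntegrableOn (fun ξ => η ξ * |φ ξ| ^ w ξ) (square T) := by
  obtain ⟨H, hH⟩ := exists_abs_le_of_continuousOn_square hη
  refine Integrable.bdd_mul (MemLVar.of_bounded hw hφm hφ).2
    (hη.aestronglyMeasurable (measurableSet_square T)) (c := H) ?_
  exact (ae_restrict_mem (measurableSet_square T)).mono hH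

/-- Elements of the Nehari manifold satisfy
`∫ |D φ|^γ = λ ∫ η |φ|^w + ∫ A |φ|^s`. -/
lemma nehari_identity (E : ChiExt T χ) (hT : 0 < T) (h : IsExponent T γ p P)
    (hw : IsExponent T w p' P') (hs : IsExponent T s p'' P'')
    (h₁ : 1 / p < α₁) (h₂ : 1 / p < α₂)
    (hα₁ : α₁ < 1) (hα₂ : α₂ < 1) (hβ0 : 0 ≤ β) (hβ1 : β ≤ 1)
    (hη : ContinuousOn η (square T)) (hA : ContinuousOn A (square T))
    (hφ : φ ∈ nehari T χ α₁ α₂ β γ w s η A lam) :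
    ∫ ξ in square T, |hilferDeriv T χ α₁ α₂ β γ φ ξ| ^ γ ξ =
      lam * (∫ ξ in square T, η ξ * |φ ξ| ^ w ξ) + ∫ ξ in square T, A ξ * |φ ξ| ^ s ξ := by
  obtain ⟨hsp, -, hd⟩ := hφ
  have hH := hasHilferDeriv_hilferDeriv hsp
  obtain ⟨C, -, hC⟩ := E.exists_abs_le_luxNorm h h₁ h₂ hα₁ hα₂ hβ0 hβ1
  have hb := hC _ _ hH
  have d1 := hasDerivAt_modular h hH.2.1.2
  have d2 := hasDerivAt_modular hw (integrableOn_weight hw hη hH.1.1 hb)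
  have d3 := hasDerivAt_modular hs (integrableOn_weight hs hA hH.1.1 hb)
  have hd' := (d1.sub (d2.const_mul lam)).sub d3
  -- For t > -1 the perturbation is the positive multiple (1+t)φ, so each term of the energy scales
  -- pointwise by a power of 1+t.
  have hE : (fun t : ℝ => energy T χ α₁ α₂ β γ w s η A lam (φ + t • φ)) =ᶠ[𝓝 0] fun t =>
      (∫ ξ in square T, 1 / γ ξ *
        ((1 + t) ^ γ ξ * |hilferDeriv T χ α₁ α₂ β γ φ ξ| ^ γ ξ)) -
      lam * (∫ ξ in square T, 1 / w ξ * ((1 + t) ^ w ξ * (η ξ * |φ ξ| ^ w ξ))) -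
      ∫ ξ in square T, 1 / s ξ * ((1 + t) ^ s ξ * (A ξ * |φ ξ| ^ s ξ)) := by
    filter_upwards [Ioi_mem_nhds (show (-1 : ℝ) < 0 by norm_num)] with t ht
    have hc : 0 < 1 + t := by linarith [mem_Ioi.1 ht]
    have hφt : φ + t • φ = fun ξ => (1 + t) * φ ξ := by
      ext ξ
      simp only [Pi.add_apply, Pi.smul_apply, smul_eq_mul]
      ring
    have habs : ∀ x y : ℝ, |(1 + t) * x| ^ y = (1 + t) ^ y * |x| ^ y := fun x y => by
      rw [abs_mul, abs_of_pos hc, Real.mul_rpow hc.le (abs_nonneg _)]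
    rw [hφt, energy]
    congr 1
    · congr 1
      · refine integral_congr_ae ?_
        filter_upwards [E.hilferDeriv_const_mul hT h h₁ h₂ hα₁ hα₂ hβ0 hβ1 hsp hc] with ξ hξ
        rw [hξ, habs]
      · congr 2
        ext ξ
        rw [habs]
        ring
    · congr 1
      ext ξ
      rw [habs]
      ring
  have huniq := HasDerivAt.unique (hd'.congr_of_eventuallyEq hE) hd
  linarith

/-- Lower bound for the energy on the Nehari manifold. -/
lemma exists_energy_lower_bound (E : ChiExt T χ) (hT : 0 < T) (h : IsExponent T γ p P)
    (hw : IsExponent T w p' P') (hs : IsExponent T s p'' P'') (hPs : P < p'')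
    (h₁ : 1 / p < α₁) (h₂ : 1 / p < α₂)
    (hα₁ : α₁ < 1) (hα₂ : α₂ < 1) (hβ0 : 0 ≤ β) (hβ1 : β ≤ 1)
    (hη : ContinuousOn η (square T)) (hη0 : ∀ ξ ∈ square T, 0 ≤ η ξ)
    (hA : ContinuousOn A (square T)) (hA0 : ∀ ξ ∈ square T, 0 ≤ A ξ) (hlam : 0 < lam) :
    ∃ a b C : ℝ, 0 < a ∧ 0 ≤ b ∧ 0 < C ∧ ∀ φ ∈ nehari T χ α₁ α₂ β γ w s η A lam,
      a * (∫ ξ in square T, |hilferDeriv T χ α₁ α₂ β γ φ ξ| ^ γ ξ) -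
        b * (1 + C * spaceNorm T χ α₁ α₂ β γ φ) ^ P' ≤
      energy T χ α₁ α₂ β γ w s η A lam φ := by
  obtain ⟨C, hC0, hC⟩ := E.exists_abs_le_luxNorm h h₁ h₂ hα₁ hα₂ hβ0 hβ1
  obtain ⟨H, hH⟩ := exists_abs_le_of_continuousOn_square hη
  have hmem := ae_restrict_mem (μ := (volume : Measure (ℝ × ℝ))) (measurableSet_square T)
  have : NeBot (ae ((volume : Measure (ℝ × ℝ)).restrict (square T))) :=
    ae_neBot.2 (volume_restrict_square_ne_zero hT)
  have hp := h.one_lt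
  have hp' := hw.one_lt
  have hp'' := hs.one_lt
  have hpP : p ≤ P := by
    obtain ⟨ξ, h1, h2⟩ := (h.le.and h.ge).exists
    exact h1.trans h2
  have hP0 : 0 < P := by linarith
  have hH0 : 0 ≤ H := (abs_nonneg _).trans (hH (0, 0) ⟨⟨le_rfl, hT.le⟩, le_rfl, hT.le⟩)
  set V := volume.real (square T)
  refine ⟨1 / P - 1 / p'', lam / p' * (H * V), C,
    sub_pos.2 (one_div_lt_one_div_of_lt hP0 hPs), by positivity, hC0, fun φ hφ => ?_⟩
  have hid := nehari_identity E hT h hw hs h₁ h₂ hα₁ hα₂ hβ0 hβ1 hη hA hφ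
  have hHD := hasHilferDeriv_hilferDeriv hφ.1
  have hb := hC _ _ hHD
  have i2 := integrableOn_weight hw hη hHD.1.1 hb
  have i3 := integrableOn_weight hs hA hHD.1.1 hb
  have hmono : ∀ {q m : ℝ × ℝ → ℝ} {c d : ℝ}, IsExponent T q c d → IntegrableOn m (square T) →
      (∀ᵐ ξ ∂volume.restrict (square T), 0 ≤ m ξ) →
      1 / d * (∫ ξ in square T, m ξ) ≤ ∫ ξ in square T, 1 / q ξ * m ξ ∧
      ∫ ξ in square T, 1 / q ξ * m ξ ≤ 1 / c * ∫ ξ in square T, m ξ := by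
    intro q m c d hq hm hm0
    have hc := hq.one_lt
    have hi : IntegrableOn (fun ξ => 1 / q ξ * m ξ) (square T) := by
      refine Integrable.bdd_mul hm (hq.aemeasurable.const_div 1).aestronglyMeasurable (c := 1) ?_
      filter_upwards [hq.le] with ξ hξ
      rw [Real.norm_of_nonneg (one_div_nonneg.2 (by linarith)), div_le_one (by linarith)]
      linarith
    rw [← integral_const_mul, ← integral_const_mul]
    constructor
    · refine integral_mono_ae (hm.const_mul _) hi ?_
      filter_upwards [hm0, hq.le, hq.ge] with ξ h0 h1 h2
      exact mul_le_mul_of_nonneg_right (one_div_le_one_div_of_le (by linarith) h2) h0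
    · refine integral_mono_ae hi (hm.const_mul _) ?_
      filter_upwards [hm0, hq.le] with ξ h0 h1
      exact mul_le_mul_of_nonneg_right (one_div_le_one_div_of_le (by linarith) h1) h0
  have e1 := (hmono h hHD.2.1.2 (ae_of_all _ fun ξ => abs_rpow_nonneg _ _)).1
  have e2 := (hmono hw i2 (hmem.mono fun ξ hξ => mul_nonneg (hη0 ξ hξ) (abs_rpow_nonneg _ _))).2
  have e3 := (hmono hs i3 (hmem.mono fun ξ hξ => mul_nonneg (hA0 ξ hξ) (abs_rpow_nonneg _ _))).2
  set ρ := ∫ ξ in square T, |hilferDeriv T χ α₁ α₂ β γ φ ξ| ^ γ ξ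
  set B := ∫ ξ in square T, η ξ * |φ ξ| ^ w ξ
  set D := ∫ ξ in square T, A ξ * |φ ξ| ^ s ξ
  set N := spaceNorm T χ α₁ α₂ β γ φ
  have hN : 0 ≤ N := luxNorm_nonneg _ _ _
  have hB0 : 0 ≤ B := integral_nonneg_of_ae
    (hmem.mono fun ξ hξ => mul_nonneg (hη0 ξ hξ) (abs_rpow_nonneg _ _))
  have hB : B ≤ H * V * (1 + C * N) ^ P' := by
    have hle : B ≤ ∫ _ in square T, H * (1 + C * N) ^ P' := by
      refine integral_mono_ae i2 (integrable_const _) ?_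
      filter_upwards [hb, hw.le, hw.ge, hmem] with ξ h1 h2 h3 h4
      have hCN : 0 ≤ C * N := mul_nonneg hC0.le hN
      have h5 : |φ ξ| ≤ 1 + C * N := h1.trans (by
        change C * N ≤ _
        linarith)
      refine mul_le_mul ((le_abs_self _).trans (hH ξ h4)) ?_ (abs_rpow_nonneg _ _) hH0
      exact (Real.rpow_le_rpow (abs_nonneg _) h5 (by linarith)).trans
        (Real.rpow_le_rpow_of_exponent_le (by linarith) h3)
    rw [setIntegral_const, smul_eq_mul] at hle
    linarith
  have hen : energy T χ α₁ α₂ β γ w s η A lam φ =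
      (∫ ξ in square T, 1 / γ ξ * |hilferDeriv T χ α₁ α₂ β γ φ ξ| ^ γ ξ) -
      lam * (∫ ξ in square T, 1 / w ξ * (η ξ * |φ ξ| ^ w ξ)) -
      ∫ ξ in square T, 1 / s ξ * (A ξ * |φ ξ| ^ s ξ) := by
    simp only [energy, mul_assoc]
  rw [hen]
  have e2' := mul_le_mul_of_nonneg_left e2 hlam.le
  have hBl := mul_le_mul_of_nonneg_left hB (show 0 ≤ lam / p' by positivity)
  have hDl : D = ρ - lam * B := by linarith
  rw [hDl] at e3
  have hx : 0 ≤ 1 / p'' * (lam * B) := by positivity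
  have e2'' : lam * (1 / p' * B) = lam / p' * B := by ring
  rw [e2''] at e2'
  -- Replacing D by ρ - λB produces a further term +(λ/s⁻)B in the lower bound, which is nonnegative
  -- and discarded.
  calc (1 / P - 1 / p'') * ρ - lam / p' * (H * V) * (1 + C * N) ^ P'
      = 1 / P * ρ - lam / p' * (H * V * (1 + C * N) ^ P') - 1 / p'' * (ρ - lam * B)
        - 1 / p'' * (lam * B) := by ring
    _ ≤ _ := by linarith

end Nehari

/-! ### Growth at infinity. -/

/-- Half the norm lies strictly below the infimum, hence is not admissible and the modular of g/k
exceeds 1. The threshold 2 makes k > 1, so that k^γ ≥ k^p. -/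
lemma le_integral_of_two_lt_luxNorm {g : ℝ × ℝ → ℝ} (h : IsExponent T γ p P)
    (hg : MemLVar T γ g) (hN : 2 < luxNorm T γ g) :
    (luxNorm T γ g / 2) ^ p ≤ ∫ ξ in square T, |g ξ| ^ γ ξ := by
  set k := luxNorm T γ g / 2
  have hk1 : 1 < k := by simp only [k]; linarith
  have hk0 : 0 < k := by linarith
  have hi := (hg.div_const h k).2
  have hgt : 1 < ∫ ξ in square T, |g ξ / k| ^ γ ξ := by
    by_contra! hle
    have : luxNorm T γ g ≤ k := csInf_le ⟨0, fun x hx => hx.1.le⟩ ⟨hk0, hi, hle⟩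
    simp only [k] at this
    linarith
  have hmono : ∫ ξ in square T, k ^ p * |g ξ / k| ^ γ ξ ≤ ∫ ξ in square T, |g ξ| ^ γ ξ := by
    refine integral_mono_ae (hi.const_mul _) hg.2 ?_
    filter_upwards [h.le] with ξ hξ
    rw [abs_div, abs_of_pos hk0, Real.div_rpow (abs_nonneg _) hk0.le, mul_div_assoc',
      div_le_iff₀ (Real.rpow_pos_of_pos hk0 _), mul_comm]
    exact mul_le_mul_of_nonneg_left (Real.rpow_le_rpow_of_exponent_le hk1.le hξ)
      (abs_rpow_nonneg _ _)
  rw [integral_const_mul] at hmono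
  have := Real.rpow_pos_of_pos hk0 p
  nlinarith

/-- For x ≥ 1 one has 1 + Cx ≤ (1+C)x, so x^q factors out and leaves a positive multiple of x^(p-q)
minus a constant. -/
lemma tendsto_rpow_sub_rpow {a b C p q : ℝ} (ha : 0 < a) (hb : 0 ≤ b) (hC : 0 < C) (hq : 0 < q)
    (hqp : q < p) :
    Tendsto (fun x : ℝ => a * (x / 2) ^ p - b * (1 + C * x) ^ q) atTop atTop := by
  have h1 : Tendsto (fun x : ℝ => a * (1 / 2) ^ p * x ^ (p - q) + -(b * (1 + C) ^ q)) atTop atTop :=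
    tendsto_atTop_add_const_right _ _
      ((tendsto_rpow_atTop (sub_pos.2 hqp)).const_mul_atTop (by positivity))
  refine tendsto_atTop_mono' _ ?_ ((tendsto_rpow_atTop hq).atTop_mul_atTop₀ h1)
  filter_upwards [eventually_ge_atTop 1] with x hx
  have hx0 : 0 < x := by linarith
  have h2 : (1 + C * x) ^ q ≤ (1 + C) ^ q * x ^ q := by
    rw [← Real.mul_rpow (by linarith) hx0.le]
    exact Real.rpow_le_rpow (by positivity) (by nlinarith) hq.le
  have h3 : (x / 2) ^ p = (1 / 2) ^ p * (x ^ q * x ^ (p - q)) := by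
    rw [← Real.rpow_add hx0, add_sub_cancel, ← Real.mul_rpow (by norm_num) hx0.le]
    congr 1
    ring
  rw [h3]
  have := mul_le_mul_of_nonneg_left h2 hb
  linarith

end

end HilferNehari

end

/-! ### Boundedness below and coercivity. -/

theorem mainTheorem5
    (T : ℝ) (hT : 0 < T)
    (χ : ℝ → ℝ) (hχ : ContDiffOn ℝ 1 χ (Set.Icc 0 T)) (hχmono : MonotoneOn χ (Set.Icc 0 T))
    (hχ' : ∀ x ∈ Set.Icc 0 T, derivWithin χ (Set.Icc 0 T) x ≠ 0)
    (γ w s : ℝ × ℝ → ℝ)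
    (hγ : ContinuousOn γ (HilferNehari.square T))
    (hw : ContinuousOn w (HilferNehari.square T))
    (hs : ContinuousOn s (HilferNehari.square T))
    (hw1 : 1 < HilferNehari.expInf T w)
    (hwγ : HilferNehari.expSup T w < HilferNehari.expInf T γ)
    (hγs : HilferNehari.expSup T γ < HilferNehari.expInf T s)
    (α₁ α₂ β : ℝ)
    (hα₁ : ∀ ξ ∈ HilferNehari.square T, 1 / γ ξ < α₁) (hα₁1 : α₁ < 1)
    (hα₂ : ∀ ξ ∈ HilferNehari.square T, 1 / γ ξ < α₂) (hα₂1 : α₂ < 1)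
    (hβ0 : 0 ≤ β) (hβ1 : β ≤ 1)
    (η A : ℝ × ℝ → ℝ)
    (hη : ContinuousOn η (HilferNehari.square T)) (hη0 : ∀ ξ ∈ HilferNehari.square T, 0 ≤ η ξ)
    (hA : ContinuousOn A (HilferNehari.square T)) (hA0 : ∀ ξ ∈ HilferNehari.square T, 0 ≤ A ξ)
    (lam : ℝ) (hlam : 0 < lam) :
    BddBelow (HilferNehari.energy T χ α₁ α₂ β γ w s η A lam ''
      HilferNehari.nehari T χ α₁ α₂ β γ w s η A lam) ∧
    Tendsto (HilferNehari.energy T χ α₁ α₂ β γ w s η A lam)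
      (comap (HilferNehari.spaceNorm T χ α₁ α₂ β γ) atTop ⊓
        𝓟 (HilferNehari.nehari T χ α₁ α₂ β γ w s η A lam))
      atTop := by
  open HilferNehari in
  obtain ⟨E⟩ := exists_chiExt hT hχ hχmono hχ'
  have hle : ∀ {q : ℝ × ℝ → ℝ} {a b : ℝ}, IsExponent T q a b → a ≤ b := fun {q a b} h => by
    have : NeBot (ae ((volume : Measure (ℝ × ℝ)).restrict (square T))) :=
      ae_neBot.2 (volume_restrict_square_ne_zero hT)
    obtain ⟨ξ, h1, h2⟩ := (h.le.and h.ge).exists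
    exact h1.trans h2
  have ew := isExponent_of_continuousOn hw hw1
  have hγ1 : 1 < expInf T γ := by linarith [hle ew]
  have eγ := isExponent_of_continuousOn hγ hγ1
  have es := isExponent_of_continuousOn hs (by linarith [hle eγ])
  obtain ⟨ξ₀, hξ₀, hmin⟩ := exists_eq_expInf hT hγ hγ1
  obtain ⟨a, b, C, ha, hb, hC, hlow⟩ := exists_energy_lower_bound E hT eγ ew es hγs
    (hmin ▸ hα₁ ξ₀ hξ₀) (hmin ▸ hα₂ ξ₀ hξ₀) hα₁1 hα₂1 hβ0 hβ1 hη hη0 hA hA0 hlam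
  have hq : 0 < expSup T w := by linarith [hle ew]
  have hlim := tendsto_rpow_sub_rpow ha hb hC hq hwγ
  have hlow2 : ∀ φ ∈ nehari T χ α₁ α₂ β γ w s η A lam, 2 < spaceNorm T χ α₁ α₂ β γ φ →
      a * (spaceNorm T χ α₁ α₂ β γ φ / 2) ^ expInf T γ -
        b * (1 + C * spaceNorm T χ α₁ α₂ β γ φ) ^ expSup T w ≤
      energy T χ α₁ α₂ β γ w s η A lam φ := fun φ hφ hN => by
    have := mul_le_mul_of_nonneg_left (le_integral_of_two_lt_luxNorm eγ
      (hasHilferDeriv_hilferDeriv hφ.1).2.1 hN) ha.le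
    exact (sub_le_sub_right this _).trans (hlow φ hφ)
  constructor
  · obtain ⟨N₀, hN₀⟩ := eventually_atTop.1 (hlim.eventually_ge_atTop 0)
    -- For norms above R the energy is nonnegative; for norms up to R only the subtracted term can
    -- be negative, and it is monotone in the norm.
    set R := max N₀ 2
    refine ⟨-(b * (1 + C * R) ^ expSup T w), ?_⟩
    rintro _ ⟨φ, hφ, rfl⟩
    have hR2 : 2 ≤ R := le_max_right _ _
    have hR : 0 ≤ (1 + C * R) ^ expSup T w := Real.rpow_nonneg (by positivity) _
    rcases lt_or_ge R (spaceNorm T χ α₁ α₂ β γ φ) with hN | hN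
    · have h1 := hN₀ _ ((le_max_left _ _).trans hN.le)
      have h2 := hlow2 φ hφ (hR2.trans_lt hN)
      linarith [mul_nonneg hb hR]
    · have hN0 : 0 ≤ spaceNorm T χ α₁ α₂ β γ φ := luxNorm_nonneg _ _ _
      have h1 : 0 ≤ a * ∫ ξ in square T, |hilferDeriv T χ α₁ α₂ β γ φ ξ| ^ γ ξ :=
        mul_nonneg ha.le (integral_nonneg fun ξ => abs_rpow_nonneg _ _)
      have h2 : (1 + C * spaceNorm T χ α₁ α₂ β γ φ) ^ expSup T w ≤ (1 + C * R) ^ expSup T w :=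
        Real.rpow_le_rpow (by positivity) (by gcongr) hq.le
      have h3 := mul_le_mul_of_nonneg_left h2 hb
      linarith [hlow φ hφ]
  · refine tendsto_atTop_mono' _ ?_ ((hlim.comp tendsto_comap).mono_left inf_le_left)
    filter_upwards [(tendsto_comap.eventually_gt_atTop 2).filter_mono inf_le_left,
      mem_inf_of_right (mem_principal_self _)] with φ h1 h2
    exact hlow2 φ h2 h1
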